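/- Let $\Omega\subset\mathbb{R}^2$ be a polygonal domain (nonempty, bounded, open, connected, with boundary a finite union of line segments), decomposed into finitely many disjoint polygonal subdomains $D_j$, i.e. $D_j\subset\Omega$ and $\overline\Omega=\bigcup_j\overline{D_j}$. Let $A:\Omega\to\mathbb{R}^{2\times2}$ satisfy, for every $j$: $A(x)$ is symmetric and $\xi^TA(x)\xi\ge|\xi|^2$ for all $x\in D_j$, $\xi\in\mathbb{R}^2$; $A$ is continuous on $D_j$; and $\|A\|_{W^{1,\infty}(D_j)}\le C_\Omega$ (the largest of the $L^\infty(D_j)$ norms of the entries of $A$ and of their first weak partial derivatives). Let $T_h$ be a conforming triangulation of $\Omega$ (finitely many nondegenerate closed triangles whose union is $\overline\Omega$, any two of which intersect exactly in the convex hull of their common vertices) with mesh size $h=\max_{\tau\in T_h}\operatorname{diam}\tau$, such that the interior of every triangle is contained in one of the $D_j$, and shape regular with parameter $\kappa>0$: every $\tau\in T_h$ contains a closed disc of radius $\operatorname{diam}(\tau)/\kappa$. Let $V_h$ be the space of functions that are continuous on $\overline\Omega$, affine on each triangle, and zero on $\partial\Omega$, and let $\Omega_h$ be the set of the vertices of $T_h$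 lying in $\Omega$. For a vertex $x$ of a triangle $\tau$ with vertices $x,y,z$ let $\omega_{\tau,x}$ be the closed quadrilateral with corners $x$, $\frac{x+y}2$, the centroid of $\tau$, and $\frac{x+z}2$, and let $\omega_x=\bigcup_{\tau\ni x}\omega_{\tau,x}$, the union being over the triangles that have $x$ as a vertex (the control volume of $x$ in the Donald dual mesh). Let $\psi_x$ be the indicator function of $\omega_x$, let $n$ be the outer unit normal of $\omega_x$, and for $u,v\in V_h$ put $$I_h^*v=\sum_{x\in\Omega_h}v(x)\psi_x,\qquad a_{FV}(u,w)=-\sum_{x\in\Omega_h}w(x)\int_{\partial\omega_x}(A\nabla u)\cdot n\,ds,\qquad a_h(u,v)=a_{FV}(u,I_h^*v),$$ $$a(u,v)=\int_\Omega\nabla u^TA\nabla v\,dx,\qquad \|u\|_a=a(u,u)^{1/2}.$$ Then for all $\kappa>0$ and $C_\Omega>0$ there is a constant $C_E>0$, depending only on $\kappa$ and $C_\Omega$ (in particular independent of $h$ and of the jumps of $A$ across the boundaries $\partial D_j$), such that in every such situation $$|a_h(u,v)-a(u,v)|\le C_E\,h\,\|u\|_a\|v\|_a\qquad\text{for all }u,v\in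 V_h.$$ -/

import Mathlib

open MeasureTheory
open scoped ContDiff

noncomputable section

namespace FVE

/-- The Euclidean plane. -/
abbrev Plane : Type := EuclideanSpace ℝ (Fin 2)

/-- A polygonal domain: a nonempty bounded connected open set whose boundary is a finite union of
nondegenerate closed line segments. -/
structure IsPolygonalDomain (Ω : Set Plane) : Prop where
  isOpen : IsOpen Ω
  isConnected : IsConnected Ω
  isBounded : Bornology.IsBounded Ω
  boundary : ∃ S : Finset (Plane × Plane), (∀ e ∈ S, e.1 ≠ e.2) ∧
    frontier Ω = ⋃ e ∈ S, segment ℝ e.1 e.2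

/-- `D 0, …, D (m-1)` is a decomposition of `Ω` into disjoint polygonal subdomains. -/
structure IsPolygonalDecomposition (Ω : Set Plane) {m : ℕ} (D : Fin m → Set Plane) : Prop where
  polygonal : ∀ j, IsPolygonalDomain (D j)
  subset : ∀ j, D j ⊆ Ω
  disjoint : Pairwise fun i j => Disjoint (D i) (D j)
  cover : closure Ω = ⋃ j, closure (D j)

/-- `g` is the weak partial derivative of `f` in the `k`-th coordinate direction on the open set
`D` (tested against smooth functions with compact support in `D`). -/
def HasWeakPartial (D : Set Plane) (f g : Plane → ℝ) (k : Fin 2) : Prop :=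
  ∀ φ : Plane → ℝ, ContDiff ℝ ∞ φ → HasCompactSupport φ → tsupport φ ⊆ D →
    ∫ x in D, f x * fderiv ℝ φ x (EuclideanSpace.single k 1) = -∫ x in D, g x * φ x

/-- `f ∈ W^{1,∞}(D)` and `‖f‖_{W^{1,∞}(D)} ≤ C`, the norm being the maximum of the `L^∞(D)` norms
of `f` and of its first order weak partial derivatives. -/
def W1InftyNormLe (D : Set Plane) (f : Plane → ℝ) (C : ℝ) : Prop :=
  (MemLp f ⊤ (volume.restrict D) ∧ ∀ᵐ x ∂(volume.restrict D), |f x| ≤ C) ∧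
    ∀ k : Fin 2, ∃ g : Plane → ℝ, HasWeakPartial D f g k ∧
      MemLp g ⊤ (volume.restrict D) ∧ ∀ᵐ x ∂(volume.restrict D), |g x| ≤ C

/-- The action of a real `2 × 2` matrix on a vector of the plane. -/
def act (M : Matrix (Fin 2) (Fin 2) ℝ) (ξ : Plane) : Plane :=
  Matrix.toEuclideanLin M ξ

/-- The assumptions on the coefficient matrix `A` relative to the subdomains `D j`: on every
subdomain it is symmetric, uniformly elliptic with constant (normalized to) `1`, continuous, and
its `W^{1,∞}` norm (maximum over the entries) is at most `C`.  Nothing is assumed on the values of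
`A` on the interfaces, which form a null set, nor on its jumps across them. -/
structure IsCoefficient {m : ℕ} (D : Fin m → Set Plane)
    (A : Plane → Matrix (Fin 2) (Fin 2) ℝ) (C : ℝ) : Prop where
  symm : ∀ j, ∀ x ∈ D j, (A x).IsSymm
  elliptic : ∀ j, ∀ x ∈ D j, ∀ ξ : Plane, ‖ξ‖ ^ 2 ≤ inner ℝ ξ (act (A x) ξ)
  continuousOn : ∀ j, ContinuousOn A (D j)
  norm_le : ∀ j, ∀ p q : Fin 2, W1InftyNormLe (D j) (fun x => A x p q) C

/-- The closed triangle with vertex set `t`. -/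
def tri (t : Finset Plane) : Set Plane := convexHull ℝ (t : Set Plane)

/-- A (conforming) triangulation of `Ω`.  A triangle is recorded by the finite set of its three
vertices; triangles are nondegenerate, two of them meet exactly in the convex hull of their common
vertices, and together they fill the closure of `Ω`. -/
structure IsTriangulation (Ω : Set Plane) (T : Finset (Finset Plane)) : Prop where
  card_eq : ∀ t ∈ T, t.card = 3
  affineIndependent : ∀ t ∈ T, AffineIndependent ℝ ((↑) : t → Plane)
  conforming : ∀ s ∈ T, ∀ t ∈ T, tri s ∩ tri t = convexHull ℝ ((s : Set Plane) ∩ (t : Set Plane))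
  cover : ⋃ t ∈ T, tri t = closure Ω

/-- Every triangle of `T` is contained in one of the subdomains `D j`, i.e. its interior is
contained in the open set `D j`. -/
def IsAligned {m : ℕ} (D : Fin m → Set Plane) (T : Finset (Finset Plane)) : Prop :=
  ∀ t ∈ T, ∃ j, interior (tri t) ⊆ D j

/-- Shape regularity with parameter `κ`: every triangle `τ` contains a disc of radius
`diam τ / κ`. -/
def IsShapeRegular (κ : ℝ) (T : Finset (Finset Plane)) : Prop :=
  ∀ t ∈ T, ∃ z : Plane, Metric.closedBall z (Metric.diam (tri t) / κ) ⊆ tri t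

/-- The mesh size `h`, the maximum of the diameters of the triangles. -/
def meshSize (T : Finset (Finset Plane)) : ℝ :=
  (T.sup fun t => Real.toNNReal (Metric.diam (tri t)) : NNReal)

open Classical in
/-- The set `Ω_h` of the vertices of the triangulation lying in the open set `Ω`. -/
def innerVertices (Ω : Set Plane) (T : Finset (Finset Plane)) : Finset Plane :=
  (T.biUnion id).filter (· ∈ Ω)

/-- Membership in `V_h`: continuous on the closure of `Ω`, affine on every triangle, and zero on
the boundary of `Ω`.  (The values outside the closure of `Ω` play no role.) -/
structure MemVh (Ω : Set Plane) (T : Finset (Finset Plane)) (u : Plane → ℝ) : Prop where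
  continuousOn : ContinuousOn u (closure Ω)
  affine : ∀ t ∈ T, ∃ ℓ : Plane →ᵃ[ℝ] ℝ, Set.EqOn u ℓ (tri t)
  boundary : ∀ x ∈ frontier Ω, u x = 0

/-- The part of the control volume of the vertex `x` in the triangle with vertex set
`t = {x, y, z}`: the (convex) quadrilateral whose corners are the centroid of the triangle, the
edge midpoints `(x + y) / 2` and `(x + z) / 2`, and `x = (x + x) / 2` itself. -/
def donaldCell (t : Finset Plane) (x : Plane) : Set Plane :=
  convexHull ℝ (insert (t.centroid ℝ id) (midpoint ℝ x '' (t : Set Plane)))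

/-- The control volume `ω_x` of the vertex `x` in the Donald dual mesh. -/
def controlVolume (T : Finset (Finset Plane)) (x : Plane) : Set Plane :=
  ⋃ t ∈ T, ⋃ _ : x ∈ t, donaldCell t x

/-- `ν` is the outer unit normal at `y` of a set `S` with polygonal boundary: near `y` the set
`S` coincides with the half plane through `y` that `ν` points out of. -/
def IsOuterUnitNormal (S : Set Plane) (y ν : Plane) : Prop :=
  ‖ν‖ = 1 ∧ ∃ r > 0, ∀ z ∈ Metric.ball y r, z ∈ S ↔ inner ℝ (z - y) ν ≤ 0

open Classical in
/-- The outer unit normal of a set with polygonal boundary (`0` at the points without one, that is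
at the finitely many corners). -/
def outerUnitNormal (S : Set Plane) (y : Plane) : Plane :=
  if h : ∃ ν, IsOuterUnitNormal S y ν then h.choose else 0

/-- The boundary integral `∫_{∂S} (A ∇u) · n ds`, with respect to arc length (the one-dimensional
Hausdorff measure). -/
def boundaryFlux (A : Plane → Matrix (Fin 2) (Fin 2) ℝ) (u : Plane → ℝ) (S : Set Plane) : ℝ :=
  ∫ y in frontier S, inner ℝ (act (A y) (gradient u y)) (outerUnitNormal S y)
    ∂(Measure.hausdorffMeasure 1)

/-- The interpolation `I_h^* v = ∑_{x ∈ Ω_h} v(x) ψ_x`, where `ψ_x` is the indicator function of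
the control volume of `x`. -/
def IhStar (Ω : Set Plane) (T : Finset (Finset Plane)) (v : Plane → ℝ) : Plane → ℝ :=
  fun y => ∑ x ∈ innerVertices Ω T, v x * (controlVolume T x).indicator (fun _ => (1 : ℝ)) y

/-- The finite volume form `a_FV(u, w) = -∑_{x ∈ Ω_h} w(x) ∫_{∂ω_x} (A ∇u) · n ds`. -/
def aFV (Ω : Set Plane) (T : Finset (Finset Plane)) (A : Plane → Matrix (Fin 2) (Fin 2) ℝ)
    (u w : Plane → ℝ) : ℝ :=
  -∑ x ∈ innerVertices Ω T, w x * boundaryFlux A u (controlVolume T x)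

/-- The finite volume element form `a_h(u, v) = a_FV(u, I_h^* v)`. -/
def ah (Ω : Set Plane) (T : Finset (Finset Plane)) (A : Plane → Matrix (Fin 2) (Fin 2) ℝ)
    (u v : Plane → ℝ) : ℝ :=
  aFV Ω T A u (IhStar Ω T v)

/-- The Galerkin form `a(u, v) = ∫_Ω ∇uᵀ A ∇v dx`. -/
def galerkin (Ω : Set Plane) (A : Plane → Matrix (Fin 2) (Fin 2) ℝ) (u v : Plane → ℝ) : ℝ :=
  ∫ x in Ω, inner ℝ (gradient u x) (act (A x) (gradient v x))

/-- The energy norm `‖u‖_a = a(u, u)^{1/2}`. -/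
def energyNorm (Ω : Set Plane) (A : Plane → Matrix (Fin 2) (Fin 2) ℝ) (u : Plane → ℝ) : ℝ :=
  √(galerkin Ω A u u)

end FVE

end

open scoped Convolution
open Filter Topology

noncomputable section

namespace FVE

/-! ### Lipschitz bounds from bounded weak derivatives -/

section Mollification

open Metric

variable {D : Set Plane} {f : Plane → ℝ} {C : ℝ}

/-! If the coefficient is constant on every triangle, the two forms agree exactly, so the error only
measures the oscillation of A inside single triangles.

Fix a triangle τ with barycentric coordinates λ, and let V and W be the constant gradients of u and
v there. The dual edge between vertices x and p runs from the edge midpoint to the centroid along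
λ_x = λ_p. Hence it is normal to ∇(λ_p - λ_x), and its length is |τ|/3 times the norm of that
gradient (`norm_centroid_sub_midpoint`). With A frozen at the centroid, its flux is therefore |τ|/3
· AV·(∇λ_p - ∇λ_x). Weighting by -v(x), summing over ordered pairs of vertices and using Σ∇λ = 0
gives |τ| AV·W, the frozen Galerkin term.

Freezing costs at most a multiple of diam τ. The interior of τ is convex and lies in one subdomain,
where mollification turns the weak derivative bounds into a Lipschitz bound along segments
(`abs_sub_le_of_segment_subset`). Jumps of A never enter. Fluxes are antisymmetric in the two
vertices, so each edge error is multiplied by a difference v(x) - v(p), of size at most |W| diam τ.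
The edge length supplies a second factor diam τ, and shape regularity bounds (diam τ)² by κ²|τ|.
This is the local estimate `abs_sum_edgeFlux_add_integral_le`.

To localize, the boundary of a control volume is identified, up to finitely many points, with a
disjoint union of dual edges (`setIntegral_frontier_controlVolume`). The geometric point is that a
point of the cell whose coordinate at x strictly dominates is interior to the control volume
(`mem_interior_controlVolume`). The local bounds are then summed by Cauchy–Schwarz and ellipticity.
-/

lemma W1InftyNormLe.locallyIntegrable_indicator (hf : W1InftyNormLe D f C)
    (hD : IsOpen D) : LocallyIntegrable (D.indicator f) :=
  ((memLp_indicator_iff_restrict hD.measurableSet).2 hf.1.1).locallyIntegrable le_top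

lemma fderiv_comp_const_sub {ρ : Plane → ℝ} (hρ : ContDiff ℝ ∞ ρ) (x z w : Plane) :
    fderiv ℝ (fun z => ρ (x - z)) z w = - fderiv ℝ ρ (x - z) w := by
  have h : HasFDerivAt (fun z => ρ (x - z))
      ((fderiv ℝ ρ (x - z)).comp (-ContinuousLinearMap.id ℝ Plane)) z := by
    apply HasFDerivAt.comp
    · exact (hρ.differentiable (by simp)).differentiableAt.hasFDerivAt
    · simpa using (hasFDerivAt_id z).const_sub x
  rw [h.fderiv]; simp

lemma abs_coord_le_norm (v : Plane) (i : Fin 2) : |v i| ≤ ‖v‖ := by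
  simpa using PiLp.norm_apply_le v i

lemma norm_le_of_apply_single (L : Plane →L[ℝ] ℝ) (hC : 0 ≤ C)
    (h : ∀ k, |L (EuclideanSpace.single k 1)| ≤ C) : ‖L‖ ≤ 2 * C := by
  refine L.opNorm_le_bound (by positivity) fun v => ?_
  have hv : v = v 0 • EuclideanSpace.single (0 : Fin 2) (1 : ℝ)
      + v 1 • EuclideanSpace.single (1 : Fin 2) (1 : ℝ) := by
    ext i; fin_cases i <;> simp
  have h0 := mul_le_mul (abs_coord_le_norm v 0) (h 0) (abs_nonneg _) (norm_nonneg v)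
  have h1 := mul_le_mul (abs_coord_le_norm v 1) (h 1) (abs_nonneg _) (norm_nonneg v)
  rw [← abs_mul] at h0 h1
  rw [hv, map_add, map_smul, map_smul, ← hv, Real.norm_eq_abs]
  refine (abs_add_le _ _).trans ?_
  simp only [smul_eq_mul]
  linarith

/-- Partial derivatives of mollifications are bounded by the bound for the weak derivatives. -/
lemma W1InftyNormLe.abs_convolution_fderiv_le (hf : W1InftyNormLe D f C) (hD : IsOpen D)
    (hC : 0 ≤ C) (φ : ContDiffBump (0 : Plane)) {x : Plane} (hx : closedBall x φ.rOut ⊆ D)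
    (k : Fin 2) :
    |(D.indicator f ⋆[ContinuousLinearMap.lsmul ℝ ℝ] fun a =>
      fderiv ℝ (φ.normed volume) a (EuclideanSpace.single k 1)) x| ≤ C := by
  obtain ⟨g, hg, hgm, hgC⟩ := hf.2 k
  set ρ := φ.normed volume
  have hρ : ContDiff ℝ ∞ ρ := φ.contDiff_normed
  have hsupp : tsupport (fun z => ρ (x - z)) = closedBall x φ.rOut := by
    have : (fun z => ρ (x - z)) = ρ ∘ (Homeomorph.subLeft x) := rfl
    rw [this, tsupport_comp_eq_preimage, φ.tsupport_normed_eq]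
    ext z
    simp [dist_eq_norm, norm_sub_rev]
  -- The reflected mollifier centred at x is an admissible test function because its support lies in
  -- D.
  have key := hg (fun z => ρ (x - z)) (hρ.comp (contDiff_const.sub contDiff_id))
    (by rw [HasCompactSupport, hsupp]; exact isCompact_closedBall _ _) (by rw [hsupp]; exact hx)
  -- The sign from differentiating z ↦ ρ(x - z) cancels the sign of the weak derivative identity.
  have e1 : (D.indicator f ⋆[ContinuousLinearMap.lsmul ℝ ℝ] fun a =>
      fderiv ℝ ρ a (EuclideanSpace.single k 1)) x = ∫ z in D, g z * ρ (x - z) := by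
    rw [convolution_def, ← neg_inj, ← key, ← integral_indicator hD.measurableSet, ← integral_neg]
    congr 1 with z
    by_cases hz : z ∈ D <;> simp [hz, fderiv_comp_const_sub hρ]
  have hint : Integrable (fun z => C * ρ (x - z)) :=
    (Integrable.comp_sub_left (f := ρ) φ.integrable_normed x).const_mul C
  rw [e1]
  calc |∫ z in D, g z * ρ (x - z)| ≤ ∫ z in D, C * ρ (x - z) := by
        rw [← Real.norm_eq_abs]
        refine norm_integral_le_of_norm_le hint.integrableOn ?_
        filter_upwards [hgC] with z hz
        rw [norm_mul, Real.norm_eq_abs, Real.norm_eq_abs, abs_of_nonneg (φ.nonneg_normed _)]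
        exact mul_le_mul_of_nonneg_right hz (φ.nonneg_normed _)
    _ ≤ ∫ z, C * ρ (x - z) :=
        setIntegral_le_integral hint (.of_forall fun z => mul_nonneg hC (φ.nonneg_normed _))
    _ = C := by
        rw [integral_const_mul, integral_sub_left_eq_self ρ volume x, φ.integral_normed, mul_one]

/-- A continuous function in `W^{1,∞}` of an open set is Lipschitz along segments in that set. -/
theorem W1InftyNormLe.abs_sub_le_of_segment_subset (hf : W1InftyNormLe D f C) (hD : IsOpen D)
    (hcont : ContinuousOn f D) (hC : 0 ≤ C) {x y : Plane} (hxy : segment ℝ x y ⊆ D) :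
    |f y - f x| ≤ 2 * C * ‖y - x‖ := by
  have hcomp : IsCompact (segment ℝ x y) := by
    rw [← convexHull_pair]; exact (Set.toFinite {x, y}).isCompact_convexHull ℝ
  -- A collar of width δ around the segment stays in D, so mollification at radius at most δ sees
  -- only values in D.
  obtain ⟨δ, hδ, hδD⟩ := hcomp.exists_cthickening_subset_open hD hxy
  have hball : ∀ z ∈ segment ℝ x y, closedBall z δ ⊆ D := fun z hz =>
    (closedBall_subset_cthickening hz δ).trans hδD
  have hxD := hxy (left_mem_segment ℝ x y)
  have hyD := hxy (right_mem_segment ℝ x y)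
  have approx : ∀ z ∈ D, ∀ ε > 0, ∃ r > 0, ∀ w ∈ ball z r,
      dist (D.indicator f w) (D.indicator f z) ≤ ε := by
    intro z hz ε hε
    have : ContinuousAt (D.indicator f) z := by
      refine (hcont.continuousAt (hD.mem_nhds hz)).congr ?_
      filter_upwards [hD.mem_nhds hz] with w hw using (Set.indicator_of_mem hw f).symm
    obtain ⟨r, hr, h⟩ := Metric.continuousAt_iff.1 this ε hε
    exact ⟨r, hr, fun w hw => (h hw).le⟩
  refine le_of_forall_pos_le_add fun ε hε => ?_
  obtain ⟨r₁, hr₁, h₁⟩ := approx x hxD (ε / 2) (half_pos hε)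
  obtain ⟨r₂, hr₂, h₂⟩ := approx y hyD (ε / 2) (half_pos hε)
  have hr : 0 < min δ (min r₁ r₂) := lt_min hδ (lt_min hr₁ hr₂)
  -- This radius keeps the support inside the collar and makes the mollified function ε/2-close to f
  -- at both endpoints. The mean value inequality for it then gives the claim up to ε.
  let φ : ContDiffBump (0 : Plane) := ⟨min δ (min r₁ r₂) / 2, min δ (min r₁ r₂),
    half_pos hr, half_lt_self hr⟩
  have hφδ : φ.rOut ≤ δ := min_le_left _ _
  have hφ₁ : φ.rOut ≤ r₁ := (min_le_right _ _).trans (min_le_left _ _)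
  have hφ₂ : φ.rOut ≤ r₂ := (min_le_right _ _).trans (min_le_right _ _)
  have hloc := hf.locallyIntegrable_indicator hD
  have a₁ := φ.dist_normed_convolution_le (μ := volume) hloc.aestronglyMeasurable
    (fun w hw => h₁ w (ball_subset_ball hφ₁ hw))
  have a₂ := φ.dist_normed_convolution_le (μ := volume) hloc.aestronglyMeasurable
    (fun w hw => h₂ w (ball_subset_ball hφ₂ hw))
  have hflip : (φ.normed volume ⋆[ContinuousLinearMap.lsmul ℝ ℝ] D.indicator f) =
      (D.indicator f ⋆[ContinuousLinearMap.lsmul ℝ ℝ] φ.normed volume) := by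
    ext z
    rw [convolution_eq_swap, convolution_def]
    simp [mul_comm]
  have hmv := Convex.norm_image_sub_le_of_norm_hasFDerivWithin_le (𝕜 := ℝ) (C := 2 * C)
    (fun z (_ : z ∈ segment ℝ x y) => (φ.hasCompactSupport_normed.hasFDerivAt_convolution_right
      (ContinuousLinearMap.lsmul ℝ ℝ) hloc (φ.contDiff_normed (μ := volume)) z).hasFDerivWithinAt)
    (fun z hz => by
      refine norm_le_of_apply_single _ hC fun k => ?_
      rw [convolution_precompR_apply (ContinuousLinearMap.lsmul ℝ ℝ) hloc
        (φ.hasCompactSupport_normed.fderiv ℝ)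
        ((φ.contDiff_normed (μ := volume) (n := 1)).continuous_fderiv one_ne_zero)]
      exact hf.abs_convolution_fderiv_le hD hC φ
        ((closedBall_subset_closedBall hφδ).trans (hball z hz)) k)
    (convex_segment x y) (left_mem_segment ℝ x y) (right_mem_segment ℝ x y)
  rw [hflip, Set.indicator_of_mem hxD, Real.dist_eq] at a₁
  rw [hflip, Set.indicator_of_mem hyD, Real.dist_eq] at a₂
  rw [Real.norm_eq_abs] at hmv
  rw [abs_le] at *
  constructor <;> linarith [a₁.1, a₁.2, a₂.1, a₂.2, hmv.1, hmv.2]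

/-- For a continuous function the `L^∞` bound holds at every point of an open set. -/
lemma W1InftyNormLe.abs_le (hf : W1InftyNormLe D f C) (hD : IsOpen D)
    (hcont : ContinuousOn f D) {x : Plane} (hx : x ∈ D) : |f x| ≤ C := by
  by_contra! h
  have hU : IsOpen (D ∩ f ⁻¹' {t | C < |t|}) :=
    hcont.isOpen_inter_preimage hD (isOpen_lt continuous_const continuous_abs)
  have hnull : volume (D ∩ f ⁻¹' {t | C < |t|}) = 0 := by
    have := (ae_restrict_iff' hD.measurableSet).1 hf.1.2
    refine measure_mono_null (fun z hz => ?_) (ae_iff.1 this)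
    simpa using hz
  exact (hU.measure_pos volume ⟨x, hx, h⟩).ne' hnull

end Mollification

/-! ### Gradients of affine functions -/

section AffineGradient

/-- The (constant) gradient of an affine function. -/
def affGrad (ℓ : Plane →ᵃ[ℝ] ℝ) : Plane :=
  (InnerProductSpace.toDual ℝ Plane).symm (LinearMap.toContinuousLinearMap ℓ.linear)

lemma inner_affGrad (ℓ : Plane →ᵃ[ℝ] ℝ) (w : Plane) : inner ℝ (affGrad ℓ) w = ℓ.linear w := by
  simp [affGrad]

lemma affine_sub_eq_inner (ℓ : Plane →ᵃ[ℝ] ℝ) (y z : Plane) :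
    ℓ z - ℓ y = inner ℝ (affGrad ℓ) (z - y) := by
  rw [inner_affGrad]
  exact (ℓ.linearMap_vsub z y).symm

lemma affGrad_sub (ℓ ℓ' : Plane →ᵃ[ℝ] ℝ) : affGrad (ℓ - ℓ') = affGrad ℓ - affGrad ℓ' := by
  refine ext_inner_right ℝ fun w => ?_
  simp [inner_sub_left, inner_affGrad]

lemma abs_affine_sub_le (ℓ : Plane →ᵃ[ℝ] ℝ) (y z : Plane) :
    |ℓ z - ℓ y| ≤ ‖affGrad ℓ‖ * ‖z - y‖ := by
  rw [affine_sub_eq_inner]; exact abs_real_inner_le_norm _ _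

lemma gradient_eq_affGrad {u : Plane → ℝ} {ℓ : Plane →ᵃ[ℝ] ℝ} {s : Set Plane}
    (h : Set.EqOn u ℓ s) {y : Plane} (hy : y ∈ interior s) : gradient u y = affGrad ℓ := by
  have hd : HasFDerivAt ℓ (LinearMap.toContinuousLinearMap ℓ.linear) y := by
    have e : (ℓ : Plane → ℝ) = fun z => (ℓ y - LinearMap.toContinuousLinearMap ℓ.linear y) +
        LinearMap.toContinuousLinearMap ℓ.linear z := by
      ext z
      have := affine_sub_eq_inner ℓ y z
      rw [inner_affGrad, map_sub] at this
      simp only [LinearMap.coe_toContinuousLinearMap']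
      linarith
    rw [e]
    exact (LinearMap.toContinuousLinearMap ℓ.linear).hasFDerivAt.const_add _
  have hu : HasFDerivAt u (LinearMap.toContinuousLinearMap ℓ.linear) y :=
    hd.congr_of_eventuallyEq (by
      filter_upwards [mem_interior_iff_mem_nhds.1 hy] with z hz using h hz)
  rw [gradient, hu.fderiv, affGrad]

end AffineGradient

/-! ### Barycentric coordinates -/

section Barycentric

/-- The vertex set of a nondegenerate triangle. -/
structure IsTriangle (t : Finset Plane) : Prop where
  card_eq : t.card = 3
  affineIndependent : AffineIndependent ℝ ((↑) : t → Plane)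

variable {t : Finset Plane}

/-- The vertices of a nondegenerate triangle as an affine basis. -/
def IsTriangle.basis (ht : IsTriangle t) : AffineBasis t ℝ Plane :=
  ⟨(↑), ht.affineIndependent, by
    rw [ht.affineIndependent.affineSpan_eq_top_iff_card_eq_finrank_add_one]
    simp [ht.card_eq]⟩

lemma IsTriangle.basis_apply (ht : IsTriangle t) (p : t) : ht.basis p = p := rfl

open Classical in
/-- The barycentric coordinate of a triangle `t` with respect to its vertex `p`. -/
def bary (t : Finset Plane) (p : Plane) : Plane →ᵃ[ℝ] ℝ :=
  -- Totality in `p : Plane`, with junk value 0, allows coordinates of different triangles at a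
  -- common vertex to be compared without subtypes.
  if h : IsTriangle t ∧ p ∈ t then h.1.basis.coord ⟨p, h.2⟩ else 0

lemma bary_eq_coord (ht : IsTriangle t) (p : t) : bary t p = ht.basis.coord p :=
  dif_pos ⟨ht, p.2⟩

lemma continuous_bary (t : Finset Plane) (p : Plane) : Continuous (bary t p) :=
  AffineMap.continuous_of_finiteDimensional _

namespace IsTriangle

variable (ht : IsTriangle t)
include ht

lemma bary_self {p : Plane} (hp : p ∈ t) : bary t p p = 1 := by
  rw [bary_eq_coord ht ⟨p, hp⟩]
  exact ht.basis.coord_apply_eq ⟨p, hp⟩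

lemma bary_ne {p q : Plane} (hp : p ∈ t) (hq : q ∈ t) (h : p ≠ q) : bary t p q = 0 := by
  rw [bary_eq_coord ht ⟨p, hp⟩]
  exact ht.basis.coord_apply_ne (i := ⟨p, hp⟩) (j := ⟨q, hq⟩) (by simpa using h)

lemma sum_bary (y : Plane) : ∑ p ∈ t, bary t p y = 1 := by
  rw [← Finset.sum_coe_sort, ← ht.basis.sum_coord_apply_eq_one y]
  exact Finset.sum_congr rfl fun p _ => by rw [bary_eq_coord ht]

lemma sum_bary_smul (y : Plane) : ∑ p ∈ t, bary t p y • p = y := by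
  rw [← Finset.sum_coe_sort]
  conv_rhs => rw [← ht.basis.linear_combination_coord_eq_self y]
  exact Finset.sum_congr rfl fun p _ => by rw [bary_eq_coord ht]; rfl

lemma range_basis : Set.range ht.basis = (t : Set Plane) := by
  ext y; simp [Set.mem_range, basis_apply]

lemma mem_tri_iff {y : Plane} : y ∈ tri t ↔ ∀ p ∈ t, 0 ≤ bary t p y := by
  rw [tri, ← ht.range_basis, ht.basis.convexHull_eq_nonneg_coord]
  simp only [Set.mem_ofPred_eq, Subtype.forall]
  exact forall₂_congr fun p hp => by rw [bary_eq_coord ht ⟨p, hp⟩]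

lemma mem_interior_tri_iff {y : Plane} : y ∈ interior (tri t) ↔ ∀ p ∈ t, 0 < bary t p y := by
  rw [tri, ← ht.range_basis, ht.basis.interior_convexHull]
  simp only [Set.mem_ofPred_eq, Subtype.forall]
  exact forall₂_congr fun p hp => by rw [bary_eq_coord ht ⟨p, hp⟩]

lemma affine_eq_sum (ℓ : Plane →ᵃ[ℝ] ℝ) (y : Plane) : ℓ y = ∑ p ∈ t, ℓ p * bary t p y := by
  have h1 : ∀ z, ℓ z = ℓ 0 + inner ℝ (affGrad ℓ) z := fun z => by
    have := affine_sub_eq_inner ℓ 0 z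
    rw [sub_zero] at this; linarith
  rw [h1 y]
  conv_lhs => rw [← ht.sum_bary_smul y]
  rw [inner_sum, ← mul_one (ℓ 0), ← ht.sum_bary y, Finset.mul_sum, ← Finset.sum_add_distrib]
  refine Finset.sum_congr rfl fun p _ => ?_
  rw [h1 p, inner_smul_right]; ring

lemma affGrad_eq_sum (ℓ : Plane →ᵃ[ℝ] ℝ) : affGrad ℓ = ∑ p ∈ t, ℓ p • affGrad (bary t p) := by
  refine ext_inner_right ℝ fun w => ?_
  have h := affine_sub_eq_inner ℓ 0 w
  rw [sub_zero, ht.affine_eq_sum ℓ w, ht.affine_eq_sum ℓ 0, ← Finset.sum_sub_distrib] at h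
  rw [← h, sum_inner]
  refine Finset.sum_congr rfl fun p _ => ?_
  have := affine_sub_eq_inner (bary t p) 0 w
  rw [sub_zero] at this
  rw [inner_smul_left, ← this]; simp; ring

lemma sum_affGrad_bary : ∑ p ∈ t, affGrad (bary t p) = 0 := by
  -- The constant 1 has every vertex value 1 and zero gradient.
  have := ht.affGrad_eq_sum (AffineMap.const ℝ Plane 1)
  simp only [AffineMap.const_apply, one_smul] at this
  rw [← this]
  refine ext_inner_right ℝ fun w => ?_
  simp [inner_affGrad]

lemma exists_third {x p : Plane} (hx : x ∈ t) (hp : p ∈ t) (hxp : x ≠ p) :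
    ∃ q, q ≠ x ∧ q ≠ p ∧ t = {x, p, q} := by
  classical
  have hc : ((t.erase x).erase p).card = 1 := by
    rw [Finset.card_erase_of_mem (Finset.mem_erase.2 ⟨hxp.symm, hp⟩),
      Finset.card_erase_of_mem hx, ht.card_eq]
  obtain ⟨q, hq⟩ := Finset.card_eq_one.1 hc
  have hqm : q ∈ (t.erase x).erase p := by rw [hq]; exact Finset.mem_singleton_self q
  simp only [Finset.mem_erase] at hqm
  refine ⟨q, hqm.2.1, hqm.1, ?_⟩
  rw [← hq, Finset.insert_erase (Finset.mem_erase.2 ⟨hxp.symm, hp⟩), Finset.insert_erase hx]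

end IsTriangle

end Barycentric

/-! ### Area of a triangle and length of its dual edges -/

section Area

lemma volume_openRefTriangle :
    volume {w : Plane | 0 < w 0 ∧ 0 < w 1 ∧ w 0 + w 1 < 1} = ENNReal.ofReal (1 / 2) := by
  have h1 := (volume_preserving_finTwoArrow ℝ).comp (PiLp.volume_preserving_ofLp (Fin 2))
  have hm : MeasurableSet (regionBetween (fun _ => (0 : ℝ)) (fun s => 1 - s) (Set.Ioo 0 1)) :=
    measurableSet_regionBetween measurable_const (by fun_prop) measurableSet_Ioo
  have h2 := h1.measure_preimage hm.nullMeasurableSet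
  have hset : (MeasurableEquiv.finTwoArrow (α := ℝ) ∘ WithLp.ofLp) ⁻¹'
      (regionBetween (fun _ => (0 : ℝ)) (fun s => 1 - s) (Set.Ioo 0 1)) =
      {w : Plane | 0 < w 0 ∧ 0 < w 1 ∧ w 0 + w 1 < 1} := by
    ext w
    simp only [regionBetween, Set.mem_preimage, Function.comp_apply, Set.mem_ofPred_eq,
      MeasurableEquiv.finTwoArrow_apply, Set.mem_Ioo]
    constructor
    · rintro ⟨⟨h, h'⟩, h'', h'''⟩; exact ⟨h, h'', by linarith⟩
    · rintro ⟨h, h', h''⟩; exact ⟨⟨h, by linarith⟩, h', by linarith⟩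
  rw [hset] at h2
  rw [h2, Measure.volume_eq_prod, volume_regionBetween_eq_integral]
  · rw [← integral_Ioc_eq_integral_Ioo, ← intervalIntegral.integral_of_le zero_le_one]
    congr 1
    simp only [Pi.sub_apply, sub_zero]
    rw [intervalIntegral.integral_sub (by simp) (by simp), integral_id]
    norm_num
  · exact integrableOn_const (by simp)
  · exact (Continuous.integrableOn_Icc (a := 0) (b := 1) (by fun_prop)).mono_set
      Set.Ioo_subset_Icc_self
  · exact measurableSet_Ioo
  · intro s hs; simpa using hs.2.le

lemma inner_plane (v w : Plane) : inner ℝ v w = v 0 * w 0 + v 1 * w 1 := by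
  simp [PiLp.inner_apply, Fin.sum_univ_two, mul_comm]

lemma norm_sq_plane (v : Plane) : ‖v‖ ^ 2 = v 0 ^ 2 + v 1 ^ 2 := by
  rw [EuclideanSpace.norm_sq_eq, Fin.sum_univ_two]; simp

variable {x p q : Plane}

/-- The determinant of the gradients of two barycentric coordinates. -/
def gradDet (t : Finset Plane) (p q : Plane) : ℝ :=
  affGrad (bary t p) 0 * affGrad (bary t q) 1 - affGrad (bary t p) 1 * affGrad (bary t q) 0

variable {t : Finset Plane}

lemma sum_triple {M : Type*} [AddCommMonoid M] (f : Plane → M) (hxp : x ≠ p) (hqx : q ≠ x)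
    (hqp : q ≠ p) (ht : t = {x, p, q}) : ∑ z ∈ t, f z = f x + f p + f q := by
  subst ht
  rw [Finset.sum_insert (by simp [hxp, hqx.symm]), Finset.sum_insert (by simp [hqp.symm]),
    Finset.sum_singleton, add_assoc]

lemma IsTriangle.inner_affGrad_bary_sub (ht : IsTriangle t) {p x y : Plane} (hp : p ∈ t)
    (hx : x ∈ t) (hpx : p ≠ x) : inner ℝ (affGrad (bary t p)) (y - x) = bary t p y := by
  rw [← affine_sub_eq_inner, ht.bary_ne hp hx hpx, sub_zero]

/-- The matrix of the two gradients is inverse to the matrix of edge vectors from x, so the product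
of the determinants is 1. -/
lemma IsTriangle.gradDet_ne_zero (ht : IsTriangle t) (hx : x ∈ t) (hp : p ∈ t) (hq : q ∈ t)
    (hxp : x ≠ p) (hqx : q ≠ x) (hqp : q ≠ p) : gradDet t p q ≠ 0 := by
  have h1 := ht.inner_affGrad_bary_sub (y := p) hp hx hxp.symm
  have h2 := ht.inner_affGrad_bary_sub (y := q) hp hx hxp.symm
  have h3 := ht.inner_affGrad_bary_sub (y := p) hq hx hqx
  have h4 := ht.inner_affGrad_bary_sub (y := q) hq hx hqx
  rw [ht.bary_self hp] at h1
  rw [ht.bary_ne hp hq hqp.symm] at h2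
  rw [ht.bary_ne hq hp hqp] at h3
  rw [ht.bary_self hq] at h4
  rw [inner_plane] at h1 h2 h3 h4
  intro h0
  have : gradDet t p q * ((p - x) 0 * (q - x) 1 - (p - x) 1 * (q - x) 0) = 1 := by
    rw [gradDet]
    linear_combination (affGrad (bary t p) 0 * (p - x) 0 + affGrad (bary t p) 1 * (p - x) 1) * h4
      + h1 - (affGrad (bary t q) 0 * (p - x) 0 + affGrad (bary t q) 1 * (p - x) 1) * h2
  rw [h0, zero_mul] at this
  exact zero_ne_one this

/-- The map y ↦ (λ_p(y), λ_q(y)) carries the interior onto the open reference triangle of area 1/2,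
and its linear part has determinant `gradDet t p q`. -/
lemma IsTriangle.volume_interior_tri (ht : IsTriangle t) (hxp : x ≠ p) (hqx : q ≠ x)
    (hqp : q ≠ p) (htt : t = {x, p, q}) :
    volume.real (interior (tri t)) = 1 / (2 * |gradDet t p q|) := by
  have hx : x ∈ t := by simp [htt]
  have hp : p ∈ t := by simp [htt]
  have hq : q ∈ t := by simp [htt]
  have hD := ht.gradDet_ne_zero hx hp hq hxp hqx hqp
  set M : Matrix (Fin 2) (Fin 2) ℝ := !![affGrad (bary t p) 0, affGrad (bary t p) 1;
    affGrad (bary t q) 0, affGrad (bary t q) 1]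
  have hdet : LinearMap.det (Matrix.toEuclideanLin M) = gradDet t p q := by
    rw [Matrix.toEuclideanLin, Matrix.toLpLin_eq_toLin, LinearMap.det_toLin,
      Matrix.det_fin_two_of, gradDet]
  have hset : interior (tri t) = (fun y => y - x) ⁻¹' (Matrix.toEuclideanLin M ⁻¹'
      {w : Plane | 0 < w 0 ∧ 0 < w 1 ∧ w 0 + w 1 < 1}) := by
    ext y
    have hs := ht.sum_bary y
    rw [sum_triple _ hxp hqx hqp htt] at hs
    have e0 : Matrix.toEuclideanLin M (y - x) 0 = bary t p y := by
      rw [← ht.inner_affGrad_bary_sub hp hx hxp.symm, inner_plane]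
      simp [Matrix.toLpLin_apply, M, dotProduct, Fin.sum_univ_two]
    have e1 : Matrix.toEuclideanLin M (y - x) 1 = bary t q y := by
      rw [← ht.inner_affGrad_bary_sub hq hx hqx, inner_plane]
      simp [Matrix.toLpLin_apply, M, dotProduct, Fin.sum_univ_two]
    rw [ht.mem_interior_tri_iff, Set.mem_preimage, Set.mem_preimage, Set.mem_ofPred_eq, e0, e1]
    constructor
    · intro h; exact ⟨h p hp, h q hq, by linarith [h x hx]⟩
    · rintro ⟨h1, h2, h3⟩ z hz
      simp only [htt, Finset.mem_insert, Finset.mem_singleton] at hz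
      obtain rfl | rfl | rfl := hz
      · linarith
      · exact h1
      · exact h2
  simp only [sub_eq_add_neg] at hset
  rw [Measure.real, hset, measure_preimage_add_right, Measure.addHaar_preimage_linearMap _
    (by rwa [hdet]), volume_openRefTriangle, ← ENNReal.ofReal_mul (abs_nonneg _),
    ENNReal.toReal_ofReal (by positivity), hdet, abs_inv]
  field_simp

/-- The centroid of a triangle. -/
lemma IsTriangle.centroid_eq (hxp : x ≠ p) (hqx : q ≠ x) (hqp : q ≠ p) (htt : t = {x, p, q}) :
    t.centroid ℝ id = (1 / 3 : ℝ) • (x + p + q) := by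
  have hc : t.card = 3 := by
    rw [htt, Finset.card_eq_three]; exact ⟨x, p, q, hxp, hqx.symm, hqp.symm, rfl⟩
  rw [Finset.centroid_eq_centerMass _ (Finset.card_pos.1 (by omega)), Finset.centerMass,
    Finset.sum_centroidWeights_eq_one_of_card_ne_zero _ _ (by omega),
    sum_triple _ hxp hqx hqp htt]
  simp only [Finset.centroidWeights_apply, hc, id]
  module

lemma IsTriangle.eq_combination (ht : IsTriangle t) (hxp : x ≠ p) (hqx : q ≠ x) (hqp : q ≠ p)
    (htt : t = {x, p, q}) (y : Plane) :
    y = bary t x y • x + bary t p y • p + bary t q y • q := by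
  conv_lhs => rw [← ht.sum_bary_smul y]
  exact sum_triple _ hxp hqx hqp htt

lemma midpoint_eq_half_smul (a b : Plane) : midpoint ℝ a b = (1 / 2 : ℝ) • (a + b) := by
  rw [midpoint_eq_smul_add]; norm_num

/-- The part of the boundary between the Donald cells of two vertices of a triangle that lies in the
interior of the triangle (without the centroid). -/
def dualEdge (t : Finset Plane) (x p : Plane) : Set Plane :=
  {y ∈ interior (tri t) | bary t x y = bary t p y ∧
    ∀ q ∈ t, q ≠ x → q ≠ p → bary t q y < bary t x y}

lemma dualEdge_comm (t : Finset Plane) (x p : Plane) : dualEdge t x p = dualEdge t p x := by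
  ext y
  constructor <;> rintro ⟨h1, h2, h3⟩ <;>
    exact ⟨h1, h2.symm, fun q hq h h' => h2 ▸ h3 q hq h' h⟩

lemma measurableSet_dualEdge (t : Finset Plane) (x p : Plane) : MeasurableSet (dualEdge t x p) := by
  refine isOpen_interior.measurableSet.inter (MeasurableSet.inter
    (s₁ := {y | bary t x y = bary t p y})
    (s₂ := {y | ∀ q ∈ t, q ≠ x → q ≠ p → bary t q y < bary t x y}) ?_ ?_)
  · exact (isClosed_eq (continuous_bary t x) (continuous_bary t p)).measurableSet
  · have : {y | ∀ q ∈ t, q ≠ x → q ≠ p → bary t q y < bary t x y} =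
        ⋂ q ∈ t, {y | q ≠ x → q ≠ p → bary t q y < bary t x y} := by ext; simp
    rw [this]
    refine Finset.measurableSet_biInter _ fun q _ => ?_
    by_cases h1 : q = x
    · simp [h1]
    by_cases h2 : q = p
    · simp [h2]
    simp only [ne_eq, h1, h2, not_false_eq_true, forall_const]
    exact (isOpen_lt (continuous_bary t q) (continuous_bary t x)).measurableSet

namespace IsTriangle

lemma dualEdge_subset_segment (ht : IsTriangle t) (hx : x ∈ t) (hp : p ∈ t) (hxp : x ≠ p) :
    dualEdge t x p ⊆ segment ℝ (midpoint ℝ x p) (t.centroid ℝ id) := by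
  obtain ⟨q, hqx, hqp, htt⟩ := ht.exists_third hx hp hxp
  have hq : q ∈ t := by simp [htt]
  rintro y ⟨hy, hyxp, hyq⟩
  have h3 := hyq q hq hqx hqp
  have h0 := ht.mem_interior_tri_iff.1 hy q hq
  have hs := ht.sum_bary y
  rw [sum_triple _ hxp hqx hqp htt] at hs
  -- On the dual edge λ_x = λ_p = (1 - λ_q)/2, and λ_q varies between 0 at the midpoint and 1/3 at
  -- the centroid.
  refine ⟨1 - 3 * bary t q y, 3 * bary t q y, by linarith, by linarith, by ring, ?_⟩
  have hxv : bary t x y = (1 - bary t q y) / 2 := by linarith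
  have hpv : bary t p y = (1 - bary t q y) / 2 := by linarith
  conv_rhs => rw [ht.eq_combination hxp hqx hqp htt y, hxv, hpv]
  rw [centroid_eq hxp hqx hqp htt, midpoint_eq_half_smul]
  module

lemma bary_midpoint (r y z : Plane) :
    bary t r (midpoint ℝ y z) = (bary t r y + bary t r z) / 2 := by
  rw [(bary t r).map_midpoint, midpoint_eq_smul_add, smul_eq_mul]; norm_num; ring

lemma bary_combination (ht : IsTriangle t) (hxp : x ≠ p) (hqx : q ≠ x) (hqp : q ≠ p)
    (htt : t = {x, p, q}) (a b c : ℝ) (habc : a + b + c = 1) :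
    bary t x (a • x + b • p + c • q) = a ∧ bary t p (a • x + b • p + c • q) = b ∧
      bary t q (a • x + b • p + c • q) = c := by
  have hx : x ∈ t := by simp [htt]
  have hp : p ∈ t := by simp [htt]
  have hq : q ∈ t := by simp [htt]
  have key : ∀ r, bary t r (a • x + b • p + c • q) =
      a * bary t r x + b * bary t r p + c * bary t r q := by
    intro r
    have h1 := affine_sub_eq_inner (bary t r) x (a • x + b • p + c • q)
    have h2 := affine_sub_eq_inner (bary t r) x p
    have h3 := affine_sub_eq_inner (bary t r) x q
    have e : a • x + b • p + c • q - x = b • (p - x) + c • (q - x) := by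
      have : a = 1 - b - c := by linarith
      rw [this]; module
    rw [e, inner_add_right, inner_smul_right, inner_smul_right, ← h2, ← h3] at h1
    linear_combination h1 - bary t r x * habc
  refine ⟨?_, ?_, ?_⟩ <;> rw [key]
  · rw [ht.bary_self hx, ht.bary_ne hx hp hxp, ht.bary_ne hx hq hqx.symm]; ring
  · rw [ht.bary_self hp, ht.bary_ne hp hx hxp.symm, ht.bary_ne hp hq hqp.symm]; ring
  · rw [ht.bary_self hq, ht.bary_ne hq hx hqx, ht.bary_ne hq hp hqp]; ring

/-- Only the two endpoints are lost, and these are negligible for arc length. -/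
lemma segment_subset_dualEdge (ht : IsTriangle t) (hx : x ∈ t) (hp : p ∈ t) (hxp : x ≠ p) :
    segment ℝ (midpoint ℝ x p) (t.centroid ℝ id) ⊆
      dualEdge t x p ∪ {midpoint ℝ x p, t.centroid ℝ id} := by
  obtain ⟨q, hqx, hqp, htt⟩ := ht.exists_third hx hp hxp
  rintro y ⟨a, b, ha, hb, hab, rfl⟩
  rcases ha.eq_or_lt with rfl | ha
  · right; right
    have : b = 1 := by linarith
    simp [this]
  rcases hb.eq_or_lt with rfl | hb
  · right; left
    have : a = 1 := by linarith
    simp [this]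
  left
  have e : a • midpoint ℝ x p + b • t.centroid ℝ id =
      (a / 2 + b / 3) • x + (a / 2 + b / 3) • p + (b / 3) • q := by
    rw [centroid_eq hxp hqx hqp htt, midpoint_eq_half_smul]; module
  obtain ⟨h1, h2, h3⟩ := ht.bary_combination hxp hqx hqp htt (a / 2 + b / 3) (a / 2 + b / 3)
    (b / 3) (by linarith)
  rw [e]
  refine ⟨ht.mem_interior_tri_iff.2 fun r hr => ?_, by rw [h1, h2], fun r hr hrx hrp => ?_⟩
  · simp only [htt, Finset.mem_insert, Finset.mem_singleton] at hr
    rw [← htt] at *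
    obtain rfl | rfl | rfl := hr
    · rw [h1]; positivity
    · rw [h2]; positivity
    · rw [h3]; positivity
  · have : r = q := by
      simp only [htt, Finset.mem_insert, Finset.mem_singleton] at hr
      tauto
    rw [this, h1, h3]; linarith

lemma centroid_mem_interior (ht : IsTriangle t) : t.centroid ℝ id ∈ interior (tri t) := by
  obtain ⟨x, p, q, hxp, hxq, hpq, htt⟩ := Finset.card_eq_three.1 ht.card_eq
  obtain ⟨h1, h2, h3⟩ := ht.bary_combination hxp hxq.symm hpq.symm htt (1 / 3) (1 / 3) (1 / 3)
    (by norm_num)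
  rw [centroid_eq hxp hxq.symm hpq.symm htt, smul_add, smul_add, ht.mem_interior_tri_iff]
  intro r hr
  have hr' : r = x ∨ r = p ∨ r = q := by simpa [htt] using hr
  obtain rfl | rfl | rfl := hr'
  · rw [h1]; norm_num
  · rw [h2]; norm_num
  · rw [h3]; norm_num

lemma midpoint_mem_tri (hx : x ∈ t) (hp : p ∈ t) : midpoint ℝ x p ∈ tri t :=
  (convex_convexHull ℝ _).midpoint_mem (subset_convexHull ℝ _ hx) (subset_convexHull ℝ _ hp)

lemma hausdorffMeasure_dualEdge (ht : IsTriangle t) (hx : x ∈ t) (hp : p ∈ t) (hxp : x ≠ p) :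
    Measure.hausdorffMeasure 1 (dualEdge t x p) =
      ENNReal.ofReal ‖t.centroid ℝ id - midpoint ℝ x p‖ := by
  have h : Measure.hausdorffMeasure 1 (segment ℝ (midpoint ℝ x p) (t.centroid ℝ id)) =
      ENNReal.ofReal ‖t.centroid ℝ id - midpoint ℝ x p‖ := by
    rw [hausdorffMeasure_segment, edist_dist, dist_eq_norm, norm_sub_rev]
  rw [← h]
  refine le_antisymm (measure_mono (ht.dualEdge_subset_segment hx hp hxp)) ?_
  refine (measure_mono (ht.segment_subset_dualEdge hx hp hxp)).trans ?_
  refine (measure_union_le _ _).trans ?_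
  have := Measure.nullSingletonClass_hausdorff Plane (d := 1) one_pos
  rw [(Set.toFinite {midpoint ℝ x p, t.centroid ℝ id}).measure_zero, add_zero]

/-- The length of a dual edge in terms of the area of the triangle. -/
lemma norm_centroid_sub_midpoint (ht : IsTriangle t) (hx : x ∈ t) (hp : p ∈ t) (hxp : x ≠ p) :
    ‖t.centroid ℝ id - midpoint ℝ x p‖ =
      volume.real (interior (tri t)) / 3 * ‖affGrad (bary t p - bary t x)‖ := by
  obtain ⟨q, hqx, hqp, htt⟩ := ht.exists_third hx hp hxp
  have hq : q ∈ t := by simp [htt]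
  have hD := ht.gradDet_ne_zero hx hp hq hxp hqx hqp
  rw [ht.volume_interior_tri hxp hqx hqp htt]
  obtain ⟨h1, h2, h3⟩ := ht.bary_combination hxp hqx hqp htt (1 / 3) (1 / 3) (1 / 3)
    (by norm_num)
  rw [← smul_add, ← smul_add, ← centroid_eq hxp hqx hqp htt] at h1 h2 h3
  have e1 := affine_sub_eq_inner (bary t p) (midpoint ℝ x p) (t.centroid ℝ id)
  have e2 := affine_sub_eq_inner (bary t q) (midpoint ℝ x p) (t.centroid ℝ id)
  rw [h2, bary_midpoint, ht.bary_self hp, ht.bary_ne hp hx hxp.symm, inner_plane] at e1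
  rw [h3, bary_midpoint, ht.bary_ne hq hp hqp, ht.bary_ne hq hx hqx, inner_plane] at e2
  have hsum := ht.sum_affGrad_bary
  rw [sum_triple _ hxp hqx hqp htt] at hsum
  have hg : affGrad (bary t p - bary t x) = (2 : ℝ) • affGrad (bary t p) + affGrad (bary t q) := by
    rw [affGrad_sub]
    have : affGrad (bary t x) = - affGrad (bary t p) - affGrad (bary t q) := by
      rw [add_assoc] at hsum
      rw [eq_neg_of_add_eq_zero_left hsum]; abel
    rw [this]; module
  rw [hg]
  set w := t.centroid ℝ id - midpoint ℝ x p
  set g := affGrad (bary t p) with hgd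
  set g' := affGrad (bary t q) with hgd'
  -- Cramer's rule: w has inner products -1/6 with g and 1/3 with g', so `gradDet t p q • w` is (2g
  -- + g')/6 rotated by a right angle.
  have hDw : ‖gradDet t p q • w‖ = ‖(1 / 6 : ℝ) • ((2 : ℝ) • g + g')‖ := by
    rw [← sq_eq_sq₀ (norm_nonneg _) (norm_nonneg _), norm_sq_plane, norm_sq_plane]
    have w0 : gradDet t p q * w 0 = -(1 / 6) * (2 * g 1 + g' 1) := by
      rw [gradDet, ← hgd, ← hgd']
      linear_combination g 1 * e2 - g' 1 * e1
    have w1 : gradDet t p q * w 1 = (1 / 6) * (2 * g 0 + g' 0) := by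
      rw [gradDet, ← hgd, ← hgd']
      linear_combination g' 0 * e1 - g 0 * e2
    simp only [PiLp.smul_apply, PiLp.add_apply, smul_eq_mul]
    rw [w0, w1]; ring
  rw [norm_smul, norm_smul, Real.norm_eq_abs, Real.norm_eq_abs,
    abs_of_pos (by norm_num : (0 : ℝ) < 1 / 6)] at hDw
  have hD' : |gradDet t p q| ≠ 0 := abs_ne_zero.2 hD
  field_simp
  linarith

end IsTriangle

end Area

lemma affineMap_sub_apply (ℓ ℓ' : Plane →ᵃ[ℝ] ℝ) (y : Plane) : (ℓ - ℓ') y = ℓ y - ℓ' y := rfl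

/-! ### Outer unit normals -/

section OuterNormal

/-- A small step from y along ν - ν' stays in the half plane of ν', hence in S. The half plane of ν
then forces ⟨ν, ν'⟩ ≥ 1, the equality case of Cauchy–Schwarz. -/
lemma IsOuterUnitNormal.unique {S : Set Plane} {y ν ν' : Plane} (h : IsOuterUnitNormal S y ν)
    (h' : IsOuterUnitNormal S y ν') : ν = ν' := by
  obtain ⟨h1, r, hr, hS⟩ := h
  obtain ⟨h1', r', hr', hS'⟩ := h'
  have hlim : ∀ᶠ ε in 𝓝[>] (0 : ℝ), y + ε • (ν - ν') ∈ Metric.ball y (min r r') := by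
    have : Tendsto (fun ε : ℝ => y + ε • (ν - ν')) (𝓝[>] 0) (𝓝 y) := by
      have : Continuous fun ε : ℝ => y + ε • (ν - ν') := by fun_prop
      simpa using (this.tendsto 0).mono_left nhdsWithin_le_nhds
    exact this.eventually (Metric.ball_mem_nhds y (lt_min hr hr'))
  obtain ⟨ε, hε, hε0⟩ := (hlim.and self_mem_nhdsWithin).exists
  have hε0 : (0 : ℝ) < ε := hε0
  have e1 := hS _ (Metric.ball_subset_ball (min_le_left _ _) hε)
  have e2 := hS' _ (Metric.ball_subset_ball (min_le_right _ _) hε)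
  rw [add_sub_cancel_left, inner_smul_left, inner_sub_left] at e1 e2
  have n1 : inner ℝ ν ν = (1 : ℝ) := by rw [real_inner_self_eq_norm_sq, h1]; norm_num
  have n2 : inner ℝ ν' ν' = (1 : ℝ) := by rw [real_inner_self_eq_norm_sq, h1']; norm_num
  have hle : inner ℝ ν ν' ≤ (1 : ℝ) := by
    simpa [h1, h1'] using real_inner_le_norm ν ν'
  have m2 : y + ε • (ν - ν') ∈ S := e2.2 (by
    rw [n2]; simp only [conj_trivial]
    exact mul_nonpos_of_nonneg_of_nonpos hε0.le (by linarith))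
  have := e1.1 m2
  rw [n1, real_inner_comm] at this
  simp only [conj_trivial] at this
  have h3 : inner ℝ ν ν' = (1 : ℝ) := by
    by_contra hne
    have : 0 < ε * (1 - inner ℝ ν ν') := mul_pos hε0 (by
      have := lt_of_le_of_ne hle hne; linarith)
    linarith
  exact (inner_eq_one_iff_of_norm_eq_one h1 h1').1 h3

lemma IsOuterUnitNormal.outerUnitNormal_eq {S : Set Plane} {y ν : Plane}
    (h : IsOuterUnitNormal S y ν) : outerUnitNormal S y = ν := by
  have hex : ∃ ν, IsOuterUnitNormal S y ν := ⟨ν, h⟩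
  rw [outerUnitNormal, dif_pos hex]
  exact hex.choose_spec.unique h

lemma IsOuterUnitNormal.mem_frontier {S : Set Plane} {y ν : Plane}
    (h : IsOuterUnitNormal S y ν) : y ∈ frontier S := by
  obtain ⟨h1, r, hr, hS⟩ := h
  refine ⟨subset_closure ((hS y (Metric.mem_ball_self hr)).2 (by simp)), fun hint => ?_⟩
  have hlim : ∀ᶠ ε in 𝓝[>] (0 : ℝ), y + ε • ν ∈ Metric.ball y r ∩ S := by
    have : Tendsto (fun ε : ℝ => y + ε • ν) (𝓝[>] 0) (𝓝 y) := by
      have : Continuous fun ε : ℝ => y + ε • ν := by fun_prop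
      simpa using (this.tendsto 0).mono_left nhdsWithin_le_nhds
    exact this.eventually (inter_mem (Metric.ball_mem_nhds y hr) (mem_interior_iff_mem_nhds.1 hint))
  obtain ⟨ε, hε, hε0⟩ := (hlim.and self_mem_nhdsWithin).exists
  have hε0 : (0 : ℝ) < ε := hε0
  have := (hS _ hε.1).1 hε.2
  rw [add_sub_cancel_left, inner_smul_left, real_inner_self_eq_norm_sq, h1] at this
  simp only [conj_trivial] at this
  linarith

end OuterNormal

/-! ### Donald cells in barycentric coordinates -/

section DonaldCell

variable {t : Finset Plane} {x p q : Plane}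

lemma convex_halfspace_bary_le (t : Finset Plane) (p x : Plane) :
    Convex ℝ {y | bary t p y ≤ bary t x y} := by
  have : {y | bary t p y ≤ bary t x y} = (bary t p - bary t x) ⁻¹' Set.Iic 0 := by
    ext y; simp
  rw [this]
  exact (convex_Iic 0).affine_preimage _

namespace IsTriangle

/-- The three medians cut the triangle into six pieces, one for each ordering of the coordinates.
Here the piece has corners x, the midpoint of x and p, and the centroid. The coordinates of y in it
are λ_x - λ_p, 2(λ_p - λ_q) and 3λ_q. -/
lemma mem_donaldCell_of_le (ht : IsTriangle t) (hxp : x ≠ p) (hqx : q ≠ x) (hqp : q ≠ p)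
    (htt : t = {x, p, q}) {y : Plane} (hq0 : 0 ≤ bary t q y) (hqp' : bary t q y ≤ bary t p y)
    (hpx : bary t p y ≤ bary t x y) : y ∈ donaldCell t x := by
  have hx : x ∈ t := by simp [htt]
  have hp : p ∈ t := by simp [htt]
  have hcent : t.centroid ℝ id ∈ donaldCell t x :=
    subset_convexHull ℝ _ (Set.mem_insert _ _)
  have hmid : ∀ r ∈ t, midpoint ℝ x r ∈ donaldCell t x := fun r hr =>
    subset_convexHull ℝ _ (Set.mem_insert_of_mem _ (Set.mem_image_of_mem _ hr))
  have hxc := hmid x hx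
  rw [midpoint_self] at hxc
  have hs := ht.sum_bary y
  rw [sum_triple _ hxp hqx hqp htt] at hs
  have hconv : Convex ℝ (donaldCell t x) := convex_convexHull ℝ _
  have key := hconv.sum_mem (t := Finset.univ)
    (w := ![bary t x y - bary t p y, 2 * (bary t p y - bary t q y), 3 * bary t q y])
    (z := ![x, midpoint ℝ x p, t.centroid ℝ id])
    (by intro i _; fin_cases i <;> simp <;> linarith)
    (by simp [Fin.sum_univ_three]; linarith)
    (by
      intro i _; fin_cases i
      · exact hxc
      · exact hmid p hp
      · exact hcent)
  rw [Fin.sum_univ_three] at key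
  simp only [Matrix.cons_val_zero, Matrix.cons_val_one, Matrix.cons_val] at key
  rw [centroid_eq hxp hqx hqp htt, midpoint_eq_half_smul] at key
  rw [ht.eq_combination hxp hqx hqp htt y]
  convert key using 1
  module

/-- The Donald cell of a vertex consists of the points at which the barycentric coordinate of that
vertex is the largest. -/
lemma mem_donaldCell_iff (ht : IsTriangle t) (hx : x ∈ t) {y : Plane} :
    y ∈ donaldCell t x ↔ y ∈ tri t ∧ ∀ p ∈ t, bary t p y ≤ bary t x y := by
  constructor
  · intro hy
    -- The right-hand side is convex, so it suffices to check the corners of the cell.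
    have hsub : donaldCell t x ⊆ tri t ∩ ⋂ p ∈ t, {y | bary t p y ≤ bary t x y} := by
      refine convexHull_min ?_ ((convex_convexHull ℝ _).inter
        (convex_iInter₂ fun p _ => convex_halfspace_bary_le t p x))
      rintro z (rfl | ⟨r, hr, rfl⟩)
      · refine ⟨interior_subset ht.centroid_mem_interior, ?_⟩
        simp only [Set.mem_iInter, Set.mem_ofPred_eq]
        intro p hp
        by_cases hxp : x = p
        · rw [hxp]
        obtain ⟨q, hqx, hqp, htt⟩ := ht.exists_third hx hp hxp
        obtain ⟨h1, h2, -⟩ := ht.bary_combination hxp hqx hqp htt (1 / 3) (1 / 3) (1 / 3)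
          (by norm_num)
        rw [centroid_eq hxp hqx hqp htt, smul_add, smul_add, h1, h2]
      · refine ⟨midpoint_mem_tri hx hr, ?_⟩
        simp only [Set.mem_iInter, Set.mem_ofPred_eq]
        intro p hp
        by_cases hxp : x = p
        · rw [hxp]
        rw [bary_midpoint, bary_midpoint, ht.bary_self hx, ht.bary_ne hp hx (Ne.symm hxp)]
        have hr' : r ∈ t := hr
        by_cases hrx : r = x
        · rw [hrx, ht.bary_self hx, ht.bary_ne hp hx (Ne.symm hxp)]; norm_num
        by_cases hrp : r = p
        · rw [hrp, ht.bary_self hp, ht.bary_ne hx hp hxp]; norm_num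
        · rw [ht.bary_ne hp hr' (Ne.symm hrp), ht.bary_ne hx hr' (Ne.symm hrx)]; norm_num
    obtain ⟨h1, h2⟩ := hsub hy
    exact ⟨h1, by simpa using h2⟩
  · rintro ⟨h1, h2⟩
    rw [ht.mem_tri_iff] at h1
    obtain ⟨p, hp, hpx⟩ := Finset.exists_mem_ne (by rw [ht.card_eq]; norm_num) x
    obtain ⟨q, hqx, hqp, htt⟩ := ht.exists_third hx hp hpx.symm
    have hq : q ∈ t := by simp [htt]
    rcases le_total (bary t q y) (bary t p y) with h | h
    · exact ht.mem_donaldCell_of_le hpx.symm hqx hqp htt (h1 q hq) h (h2 p hp)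
    · refine ht.mem_donaldCell_of_le hqx.symm hpx hqp.symm ?_ (h1 p hp) h (h2 q hq)
      rw [htt]; ext; simp [or_comm]

end IsTriangle

lemma isClosed_tri (t : Finset Plane) : IsClosed (tri t) :=
  (t.finite_toSet.isCompact_convexHull ℝ).isClosed

lemma isClosed_controlVolume (T : Finset (Finset Plane)) (x : Plane) :
    IsClosed (controlVolume T x) := by
  refine T.finite_toSet.isClosed_biUnion fun t _ => ?_
  refine isClosed_iUnion_of_finite fun _ => ?_
  exact (((t.finite_toSet.image _).insert _).isCompact_convexHull ℝ).isClosed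

end DonaldCell

/-! ### Conforming triangulations and the boundary of control volumes -/

section Triangulation

variable {Ω : Set Plane} {T : Finset (Finset Plane)} {s t : Finset Plane} {x y p : Plane}

lemma mem_controlVolume {T : Finset (Finset Plane)} :
    y ∈ controlVolume T x ↔ ∃ t ∈ T, x ∈ t ∧ y ∈ donaldCell t x := by
  simp only [controlVolume, Set.mem_iUnion, exists_prop]

lemma mem_innerVertices : x ∈ innerVertices Ω T ↔ (∃ t ∈ T, x ∈ t) ∧ x ∈ Ω := by
  simp [innerVertices]

lemma subset_tri (t : Finset Plane) (hx : x ∈ t) : x ∈ tri t := subset_convexHull ℝ _ hx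

namespace IsTriangulation

variable (hT : IsTriangulation Ω T)
include hT

lemma isTriangle (ht : t ∈ T) : IsTriangle t := ⟨hT.card_eq t ht, hT.affineIndependent t ht⟩

/-- By conformity the intersection is the hull of the common vertices, and the two affine functions
agree at those. -/
lemma bary_eq_of_mem_inter (hs : s ∈ T) (ht : t ∈ T) (hy : y ∈ tri s ∩ tri t)
    (hps : p ∈ s) (hpt : p ∈ t) : bary s p y = bary t p y := by
  rw [hT.conforming s hs t ht] at hy
  have : convexHull ℝ ((s : Set Plane) ∩ t) ⊆ (bary s p - bary t p) ⁻¹' {0} := by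
    refine convexHull_min ?_ ((convex_singleton 0).affine_preimage _)
    rintro z ⟨hzs, hzt⟩
    have hzs : z ∈ s := hzs
    have hzt : z ∈ t := hzt
    by_cases h : p = z
    · subst h; simp [(hT.isTriangle hs).bary_self hps, (hT.isTriangle ht).bary_self hpt]
    · simp [(hT.isTriangle hs).bary_ne hps hzs h, (hT.isTriangle ht).bary_ne hpt hzt h]
  have := this hy
  simp only [Set.mem_preimage, affineMap_sub_apply, Set.mem_singleton_iff] at this
  linarith

lemma bary_eq_zero_of_mem_inter (hs : s ∈ T) (ht : t ∈ T) (hy : y ∈ tri s ∩ tri t)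
    (hps : p ∈ s) (hpt : p ∉ t) : bary s p y = 0 := by
  rw [hT.conforming s hs t ht] at hy
  have : convexHull ℝ ((s : Set Plane) ∩ t) ⊆ bary s p ⁻¹' {0} := by
    refine convexHull_min ?_ ((convex_singleton 0).affine_preimage _)
    rintro z ⟨hzs, hzt⟩
    have hzs : z ∈ s := hzs
    have hzt : z ∈ t := hzt
    exact (hT.isTriangle hs).bary_ne hps hzs (fun h => hpt (h ▸ hzt))
  exact this hy

/-- Otherwise t has a vertex outside s, whose coordinate would vanish on the intersection although
it is positive in the interior of t. -/
lemma eq_of_mem_interior (hs : s ∈ T) (ht : t ∈ T) (hys : y ∈ tri s)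
    (hyt : y ∈ interior (tri t)) : s = t := by
  by_contra hne
  have : ¬ t ⊆ s := fun h =>
    hne (Finset.eq_of_subset_of_card_le h (by rw [hT.card_eq s hs, hT.card_eq t ht])).symm
  obtain ⟨r, hrt, hrs⟩ := Finset.not_subset.1 this
  have h0 := hT.bary_eq_zero_of_mem_inter ht hs ⟨interior_subset hyt, hys⟩ hrt hrs
  exact ((hT.isTriangle ht).mem_interior_tri_iff.1 hyt r hrt).ne' h0

lemma mem_of_mem_tri (hs : s ∈ T) (ht : t ∈ T) (hx : x ∈ t) (hxs : x ∈ tri s) : x ∈ s := by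
  by_contra h
  have h0 := hT.bary_eq_zero_of_mem_inter ht hs ⟨subset_tri t hx, hxs⟩ hx h
  rw [(hT.isTriangle ht).bary_self hx] at h0
  exact one_ne_zero h0

/-- Dominance of a vertex coordinate carries over to all triangles in whose cone a point lies. -/
lemma bary_lt_of_mem_cone (hs : s ∈ T) (ht : t ∈ T) (hxs : x ∈ s) (hxt : x ∈ t)
    (hy : y ∈ tri t) (hdom : ∀ p ∈ t, p ≠ x → bary t p y < bary t x y)
    (hcone : ∀ p ∈ s, p ≠ x → 0 ≤ bary s p y) :
    ∀ p ∈ s, p ≠ x → bary s p y < bary s x y := by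
  have hts := hT.isTriangle hs
  have htt := hT.isTriangle ht
  -- With this ε the point w = x + ε(y - x) has coordinate at x at least 1 - ε(1 + |λ_x(y)|) = 0 in
  -- s, so w lies in both triangles. Coordinates are compared at w and scaled back from x to y.
  set ε : ℝ := 1 / (1 + |bary s x y|)
  have hden : 0 < 1 + |bary s x y| := by positivity
  have hε : 0 < ε := by positivity
  have hε1 : ε ≤ 1 := by
    rw [div_le_one hden]; linarith [abs_nonneg (bary s x y)]
  have hεm : ε * (1 + |bary s x y|) = 1 := by simp only [ε]; field_simp
  set w := AffineMap.lineMap x y ε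
  have hw : ∀ r p, bary r p w = bary r p x + ε * (bary r p y - bary r p x) := by
    intro r p
    rw [(bary r p).apply_lineMap, AffineMap.lineMap_apply]
    simp; ring
  have hwt : w ∈ tri t := by
    have := (convex_convexHull ℝ (t : Set Plane)).lineMap_mem (subset_tri t hxt) hy ⟨hε.le, hε1⟩
    exact this
  have hws : w ∈ tri s := by
    rw [hts.mem_tri_iff]
    intro p hp
    rw [hw]
    by_cases hpx : p = x
    · subst hpx
      rw [hts.bary_self hp]
      nlinarith [neg_abs_le (bary s p y)]
    · rw [hts.bary_ne hp hxs hpx]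
      have := mul_nonneg hε.le (hcone p hp hpx)
      linarith
  have hxx : bary s x y = bary t x y := by
    have := hT.bary_eq_of_mem_inter hs ht ⟨hws, hwt⟩ hxs hxt
    rw [hw, hw, hts.bary_self hxs, htt.bary_self hxt] at this
    have := mul_left_cancel₀ hε.ne' (add_left_cancel this)
    linarith
  intro p hp hpx
  rw [hxx]
  by_cases hpt : p ∈ t
  · have := hT.bary_eq_of_mem_inter hs ht ⟨hws, hwt⟩ hp hpt
    rw [hw, hw, hts.bary_ne hp hxs hpx, htt.bary_ne hpt hxt hpx] at this
    have := mul_left_cancel₀ hε.ne' (add_left_cancel this)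
    linarith [hdom p hpt hpx]
  -- For a vertex of s that t lacks, the coordinate of y in s is 0, while strict dominance in t
  -- makes the coordinate at x positive.
  · have := hT.bary_eq_zero_of_mem_inter hs ht ⟨hws, hwt⟩ hp hpt
    rw [hw, hts.bary_ne hp hxs hpx, zero_add, sub_zero] at this
    have h0 : bary s p y = 0 := by
      rcases mul_eq_zero.1 this with h | h
      · exact absurd h hε.ne'
      · exact h
    rw [h0]
    obtain ⟨r, hr, hrx⟩ := Finset.exists_mem_ne (by rw [htt.card_eq]; norm_num) x
    exact (htt.mem_tri_iff.1 hy r hr).trans_lt (hdom r hr hrx)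

/-- Triangles without the vertex x are closed and, by conformity, miss x. The others must therefore
cover a neighbourhood of x, as Ω is open. -/
lemma eventually_mem_star (hΩ : IsOpen Ω) (ht : t ∈ T) (hxt : x ∈ t) (hx : x ∈ Ω) :
    ∀ᶠ z in 𝓝 x, ∃ s ∈ T, x ∈ s ∧ z ∈ tri s := by
  have h1 : ∀ᶠ z in 𝓝 x, ∀ s ∈ T, x ∉ s → z ∉ tri s := by
    rw [Finset.eventually_all]
    intro s hs
    by_cases hxs : x ∈ s
    · exact .of_forall fun z h => absurd hxs h
    · have : x ∉ tri s := fun h => hxs (hT.mem_of_mem_tri hs ht hxt h)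
      filter_upwards [(isClosed_tri s).isOpen_compl.mem_nhds this] with z hz _ using hz
  filter_upwards [h1, hΩ.mem_nhds hx] with z hz hzΩ
  have := subset_closure hzΩ
  rw [← hT.cover] at this
  simp only [Set.mem_iUnion, exists_prop] at this
  obtain ⟨s, hs, hzs⟩ := this
  refine ⟨s, hs, ?_, hzs⟩
  by_contra h
  exact hz s hs h hzs

/-- Shrinking towards an interior vertex x shows that every z near y lies in the cone at x of some
triangle of the star. Cones missing y are avoided near y. In cones containing y, dominance carries
over by `bary_lt_of_mem_cone` and persists by continuity. -/
lemma mem_interior_controlVolume (hΩ : IsOpen Ω) (ht : t ∈ T) (hxt : x ∈ t) (hx : x ∈ Ω)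
    (hy : y ∈ tri t) (hdom : ∀ p ∈ t, p ≠ x → bary t p y < bary t x y) :
    y ∈ interior (controlVolume T x) := by
  obtain ⟨ε, hstar, hε⟩ : ∃ ε : ℝ,
      (∀ᶠ z in 𝓝 (AffineMap.lineMap x y ε), ∃ s ∈ T, x ∈ s ∧ z ∈ tri s) ∧
      0 < ε := by
    have hlim : Tendsto (fun ε : ℝ => AffineMap.lineMap x y ε) (𝓝[>] 0) (𝓝 x) := by
      have : Continuous fun ε : ℝ => AffineMap.lineMap x y ε := AffineMap.lineMap_continuous
      simpa using (this.tendsto 0).mono_left nhdsWithin_le_nhds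
    exact ((hlim.eventually (hT.eventually_mem_star hΩ ht hxt hx).eventually_nhds).and
      self_mem_nhdsWithin).exists
  have hcont : Continuous fun z : Plane => AffineMap.lineMap x z ε := by
    simp only [AffineMap.lineMap_apply]
    fun_prop
  have h1 : ∀ᶠ z in 𝓝 y, ∃ s ∈ T, x ∈ s ∧ AffineMap.lineMap x z ε ∈ tri s :=
    (hcont.tendsto y).eventually hstar
  have h2 : ∀ᶠ z in 𝓝 y, ∀ s ∈ T, x ∈ s → (∀ p ∈ s, p ≠ x → 0 ≤ bary s p z) →
      ∀ p ∈ s, p ≠ x → bary s p z < bary s x z := by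
    rw [Finset.eventually_all]
    intro s hs
    by_cases hxs : x ∈ s
    swap
    · exact .of_forall fun z h => absurd h hxs
    by_cases hcone : ∀ p ∈ s, p ≠ x → 0 ≤ bary s p y
    · have hd := hT.bary_lt_of_mem_cone hs ht hxs hxt hy hdom hcone
      have : ∀ᶠ z in 𝓝 y, ∀ p ∈ s, p ≠ x → bary s p z < bary s x z := by
        rw [Finset.eventually_all]
        intro p hp
        by_cases hpx : p = x
        · exact .of_forall fun z h => absurd hpx h
        filter_upwards [(continuous_bary s p).continuousAt.eventually_lt
          (continuous_bary s x).continuousAt (hd p hp hpx)] with z hz _ using hz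
      filter_upwards [this] with z hz _ _ using hz
    · push Not at hcone
      obtain ⟨p, hp, hpx, hneg⟩ := hcone
      filter_upwards [(continuous_bary s p).continuousAt.eventually_lt
        continuousAt_const hneg] with z hz _ hc
      exact absurd (hc p hp hpx) (not_le.2 hz)
  rw [mem_interior_iff_mem_nhds]
  filter_upwards [h1, h2] with z ⟨s, hs, hxs, hzs⟩ hz
  have hts := hT.isTriangle hs
  have hc : ∀ p ∈ s, p ≠ x → 0 ≤ bary s p z := by
    intro p hp hpx
    have := hts.mem_tri_iff.1 hzs p hp
    rw [(bary s p).apply_lineMap, AffineMap.lineMap_apply, hts.bary_ne hp hxs hpx] at this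
    simp only [vsub_eq_sub, sub_zero, smul_eq_mul, vadd_eq_add, add_zero] at this
    exact nonneg_of_mul_nonneg_right this hε
  have hd := hz s hs hxs hc
  have hle : ∀ p ∈ s, bary s p z ≤ bary s x z := fun p hp => by
    by_cases hpx : p = x
    · rw [hpx]
    · exact (hd p hp hpx).le
  refine mem_controlVolume.2 ⟨s, hs, hxs, (hts.mem_donaldCell_iff hxs).2 ⟨?_, hle⟩⟩
  -- The coordinate at x dominates a nonnegative one, so z lies in the triangle itself and not
  -- merely in its cone.
  obtain ⟨r, hr, hrx⟩ := Finset.exists_mem_ne (by rw [hts.card_eq]; norm_num) x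
  refine hts.mem_tri_iff.2 fun p hp => ?_
  by_cases hpx : p = x
  · rw [hpx]; exact (hc r hr hrx).trans (hle r hr)
  · exact hc p hp hpx

lemma mem_controlVolume_iff_of_mem_interior (ht : t ∈ T) (hxt : x ∈ t)
    (hy : y ∈ interior (tri t)) :
    y ∈ controlVolume T x ↔ ∀ p ∈ t, bary t p y ≤ bary t x y := by
  rw [mem_controlVolume]
  constructor
  · rintro ⟨s, hs, hxs, hys⟩
    have hys' := ((hT.isTriangle hs).mem_donaldCell_iff hxs).1 hys
    have := hT.eq_of_mem_interior hs ht hys'.1 hy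
    subst this
    exact hys'.2
  · intro h
    exact ⟨t, ht, hxt, ((hT.isTriangle ht).mem_donaldCell_iff hxt).2 ⟨interior_subset hy, h⟩⟩

/-- Near a point of the open dual edge the only active constraint of the cell is λ_p ≤ λ_x, a half
plane with normal direction ∇(λ_p - λ_x). -/
lemma isOuterUnitNormal_of_mem_dualEdge (ht : t ∈ T) (hxt : x ∈ t) (hpt : p ∈ t) (hxp : x ≠ p)
    (hy : y ∈ dualEdge t x p) :
    IsOuterUnitNormal (controlVolume T x) y
      (‖affGrad (bary t p - bary t x)‖⁻¹ • affGrad (bary t p - bary t x)) := by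
  have htt := hT.isTriangle ht
  obtain ⟨hyi, hyxp, hyq⟩ := hy
  set g := affGrad (bary t p - bary t x)
  have hg : g ≠ 0 := by
    intro h0
    have := affine_sub_eq_inner (bary t p - bary t x) x p
    rw [show affGrad (bary t p - bary t x) = 0 from h0, inner_zero_left] at this
    simp only [affineMap_sub_apply] at this
    rw [htt.bary_self hpt, htt.bary_self hxt, htt.bary_ne hpt hxt hxp.symm,
      htt.bary_ne hxt hpt hxp] at this
    norm_num at this
  have hgn : 0 < ‖g‖ := norm_pos_iff.2 hg
  refine ⟨by rw [norm_smul, norm_inv, norm_norm, inv_mul_cancel₀ hgn.ne'], ?_⟩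
  have hev : ∀ᶠ z in 𝓝 y, z ∈ interior (tri t) ∧
      ∀ q ∈ t, q ≠ x → q ≠ p → bary t q z < bary t x z := by
    refine Filter.Eventually.and (isOpen_interior.mem_nhds hyi) ?_
    rw [Finset.eventually_all]
    intro q hq
    by_cases h1 : q = x
    · exact .of_forall fun z h => absurd h1 h
    by_cases h2 : q = p
    · exact .of_forall fun z _ h => absurd h2 h
    filter_upwards [(continuous_bary t q).continuousAt.eventually_lt
      (continuous_bary t x).continuousAt (hyq q hq h1 h2)] with z hz _ _ using hz
  obtain ⟨r, hr, hball⟩ := Metric.eventually_nhds_iff_ball.1 hev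
  refine ⟨r, hr, fun z hz => ?_⟩
  obtain ⟨hzi, hzq⟩ := hball z hz
  rw [hT.mem_controlVolume_iff_of_mem_interior ht hxt hzi, inner_smul_right, real_inner_comm,
    ← affine_sub_eq_inner]
  simp only [affineMap_sub_apply]
  have hiff : ‖g‖⁻¹ * (bary t p z - bary t x z - (bary t p y - bary t x y)) ≤ 0 ↔
      bary t p z ≤ bary t x z := by
    rw [← hyxp, sub_self, sub_zero, mul_nonpos_iff_pos_imp_nonpos]
    constructor
    · intro h; linarith [h.1 (inv_pos.2 hgn)]
    · intro h; refine ⟨fun _ => by linarith, fun _ => (inv_pos.2 hgn).le⟩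
  rw [hiff]
  constructor
  · intro h; exact h p hpt
  · intro h q hq
    by_cases h1 : q = x
    · rw [h1]
    by_cases h2 : q = p
    · rw [h2]; exact h
    exact (hzq q hq h1 h2).le

/-- Up to midpoints and centroids the boundary of a control volume consists of dual edges. -/
lemma mem_frontier_controlVolume (hΩ : IsOpen Ω) (hx : x ∈ Ω)
    (hy : y ∈ frontier (controlVolume T x)) :
    ∃ t ∈ T, x ∈ t ∧ ∃ p ∈ t, p ≠ x ∧
      (y ∈ dualEdge t x p ∨ y = midpoint ℝ x p ∨ y = t.centroid ℝ id) := by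
  rw [(isClosed_controlVolume T x).frontier_eq] at hy
  obtain ⟨t, ht, hxt, hyc⟩ := mem_controlVolume.1 hy.1
  have htt := hT.isTriangle ht
  obtain ⟨hyt, hyle⟩ := (htt.mem_donaldCell_iff hxt).1 hyc
  -- Strict dominance would make y interior, so some coordinate ties with that of x.
  have hnd : ¬ ∀ p ∈ t, p ≠ x → bary t p y < bary t x y := fun h =>
    hy.2 (hT.mem_interior_controlVolume hΩ ht hxt hx hyt h)
  push Not at hnd
  obtain ⟨p, hp, hpx, hge⟩ := hnd
  refine ⟨t, ht, hxt, p, hp, hpx, ?_⟩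
  obtain ⟨q, hqx, hqp, httt⟩ := htt.exists_third hxt hp hpx.symm
  have hq : q ∈ t := by simp [httt]
  have hxp := le_antisymm hge (hyle p hp)
  have hs := htt.sum_bary y
  rw [sum_triple _ hpx.symm hqx hqp httt] at hs
  have hy0 := htt.mem_tri_iff.1 hyt
  have hc := htt.eq_combination hpx.symm hqx hqp httt y
  -- A triple tie is the centroid, a vanishing third coordinate the midpoint, and anything else lies
  -- on the open dual edge.
  rcases (hyle q hq).eq_or_lt with h | h
  · right; right
    rw [hc, IsTriangle.centroid_eq hpx.symm hqx hqp httt, h, ← hxp,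
      show bary t x y = 1 / 3 by linarith]
    module
  rcases (hy0 q hq).eq_or_lt with h0 | h0
  · right; left
    rw [hc, midpoint_eq_half_smul, ← h0, ← hxp, show bary t x y = 1 / 2 by linarith]
    module
  · left
    refine ⟨htt.mem_interior_tri_iff.2 fun r hr => ?_, hxp, fun r hr h1 h2 => ?_⟩
    · have hr' : r = x ∨ r = p ∨ r = q := by simpa [httt] using hr
      obtain rfl | rfl | rfl := hr' <;> linarith
    · have hr' : r = x ∨ r = p ∨ r = q := by simpa [httt] using hr
      have : r = q := by tauto
      rw [this]; exact h

/-- A vertex lies in its own control volume and in no other, since its own coordinate is 1 and the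
others vanish there. -/
lemma IhStar_eq (v : Plane → ℝ) (hx : x ∈ innerVertices Ω T) : IhStar Ω T v x = v x := by
  rw [IhStar, Finset.sum_eq_single_of_mem x hx]
  · obtain ⟨⟨t, ht, hxt⟩, -⟩ := mem_innerVertices.1 hx
    have htt := hT.isTriangle ht
    have : x ∈ controlVolume T x := by
      refine mem_controlVolume.2 ⟨t, ht, hxt, (htt.mem_donaldCell_iff hxt).2
        ⟨subset_tri t hxt, fun p hp => ?_⟩⟩
      by_cases hpx : p = x
      · rw [hpx]
      · rw [htt.bary_self hxt, htt.bary_ne hp hxt hpx]; norm_num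
    simp [this]
  · intro x' hx' hne
    have : x ∉ controlVolume T x' := by
      intro h
      obtain ⟨s, hs, hxs, hc⟩ := mem_controlVolume.1 h
      obtain ⟨⟨t, ht, hxt⟩, -⟩ := mem_innerVertices.1 hx
      have hts := hT.isTriangle hs
      obtain ⟨h1, h2⟩ := (hts.mem_donaldCell_iff hxs).1 hc
      have hxs' := hT.mem_of_mem_tri hs ht hxt h1
      have := h2 x hxs'
      rw [hts.bary_self hxs', hts.bary_ne hxs hxs' hne] at this
      norm_num at this
    simp [this]

end IsTriangulation

end Triangulation

/-! ### Freezing the coefficient -/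

section Coefficient

lemma inner_act (M : Matrix (Fin 2) (Fin 2) ℝ) (v w : Plane) :
    inner ℝ (act M v) w =
      M 0 0 * v 0 * w 0 + M 0 1 * v 1 * w 0 + M 1 0 * v 0 * w 1 + M 1 1 * v 1 * w 1 := by
  rw [inner_plane]
  simp [act, Matrix.toLpLin_apply]
  ring

lemma act_sub (M N : Matrix (Fin 2) (Fin 2) ℝ) (v : Plane) :
    act (M - N) v = act M v - act N v := by simp [act]

lemma inner_act_comm {M : Matrix (Fin 2) (Fin 2) ℝ} (hM : M.IsSymm) (v w : Plane) :
    inner ℝ v (act M w) = inner ℝ (act M v) w := by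
  have h : M 1 0 = M 0 1 := hM.apply 0 1
  rw [real_inner_comm, inner_act, inner_act, h]; ring

lemma abs_inner_act_le {M : Matrix (Fin 2) (Fin 2) ℝ} {L : ℝ} (hM : ∀ i j, |M i j| ≤ L)
    (v w : Plane) : |inner ℝ (act M v) w| ≤ 4 * L * (‖v‖ * ‖w‖) := by
  have hterm : ∀ i j, |M i j * v j * w i| ≤ L * (‖v‖ * ‖w‖) := fun i j => by
    rw [mul_assoc, abs_mul, abs_mul]
    exact mul_le_mul (hM i j) (mul_le_mul (abs_coord_le_norm v j) (abs_coord_le_norm w i)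
      (abs_nonneg _) (norm_nonneg _)) (by positivity) ((abs_nonneg _).trans (hM i j))
  rw [inner_act]
  have h1 := abs_le.1 (hterm 0 0)
  have h2 := abs_le.1 (hterm 0 1)
  have h3 := abs_le.1 (hterm 1 0)
  have h4 := abs_le.1 (hterm 1 1)
  rw [abs_le]
  constructor <;> linarith [h1.1, h1.2, h2.1, h2.2, h3.1, h3.2, h4.1, h4.2]

variable {U S : Set Plane} {A : Plane → Matrix (Fin 2) (Fin 2) ℝ} {c : Plane} {L : ℝ}
  {μ : Measure Plane}

lemma continuousOn_inner_act (hA : ContinuousOn A U) (v w : Plane) :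
    ContinuousOn (fun y => inner ℝ (act (A y) v) w) U := by
  have h : ∀ i j, ContinuousOn (fun y => A y i j) U := fun i j =>
    (continuous_apply_apply i j).comp_continuousOn hA
  simp only [inner_act]
  have := h 0 0; have := h 0 1; have := h 1 0; have := h 1 1
  fun_prop

/-- The measure is left general so that the result serves both area and arc length. -/
lemma integrableOn_inner_act (hA : ContinuousOn A U) (hL : ∀ y ∈ U, ∀ i j, |A y i j - A c i j| ≤ L)
    (hSU : S ⊆ U) (hS : MeasurableSet S) (hμ : μ S ≠ ⊤) (v w : Plane) :
    IntegrableOn (fun y => inner ℝ (act (A y) v) w) S μ := by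
  refine IntegrableOn.of_bound hμ.lt_top
    (((continuousOn_inner_act hA v w).mono hSU).aestronglyMeasurable hS)
    (4 * L * (‖v‖ * ‖w‖) + |inner ℝ (act (A c) v) w|) ?_
  filter_upwards [ae_restrict_mem hS] with y hy
  have := abs_inner_act_le (M := A y - A c) (L := L) (hL y (hSU hy)) v w
  rw [act_sub, inner_sub_left] at this
  rw [Real.norm_eq_abs]
  calc _ = |(inner ℝ (act (A y) v) w - inner ℝ (act (A c) v) w) + inner ℝ (act (A c) v) w| := by
        rw [sub_add_cancel]
    _ ≤ _ := (abs_add_le _ _).trans (add_le_add_left this _)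

/-- Freezing a nearly constant coefficient in an integral. -/
lemma abs_setIntegral_inner_act_sub_le (hA : ContinuousOn A U)
    (hL : ∀ y ∈ U, ∀ i j, |A y i j - A c i j| ≤ L)
    (hSU : S ⊆ U) (hS : MeasurableSet S) (hμ : μ S ≠ ⊤) (v w : Plane) :
    |(∫ y in S, inner ℝ (act (A y) v) w ∂μ) - μ.real S * inner ℝ (act (A c) v) w| ≤
      4 * L * (‖v‖ * ‖w‖) * μ.real S := by
  have hint := integrableOn_inner_act hA hL hSU hS hμ v w
  have e : (∫ y in S, inner ℝ (act (A y) v) w ∂μ) - μ.real S * inner ℝ (act (A c) v) w =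
      ∫ y in S, inner ℝ (act (A y - A c) v) w ∂μ := by
    simp only [act_sub, inner_sub_left]
    rw [integral_sub hint (integrableOn_const hμ), setIntegral_const, smul_eq_mul]
  rw [e, ← Real.norm_eq_abs]
  exact norm_setIntegral_le_of_norm_le_const hμ.lt_top fun y hy =>
    abs_inner_act_le (M := A y - A c) (hL y (hSU hy)) v w

end Coefficient

/-! ### Splitting integrals over the mesh -/

section Decomposition

variable {Ω : Set Plane} {T : Finset (Finset Plane)} {x : Plane}

open Classical in
lemma IsTriangulation.setIntegral_frontier_controlVolume (hT : IsTriangulation Ω T)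
    (hΩ : IsOpen Ω) (hx : x ∈ Ω) {F : Plane → ℝ}
    (hF : ∀ t ∈ T, x ∈ t → ∀ p ∈ t.erase x,
      IntegrableOn F (dualEdge t x p) (Measure.hausdorffMeasure 1)) :
    ∫ y in frontier (controlVolume T x), F y ∂(Measure.hausdorffMeasure 1) =
      ∑ t ∈ T with x ∈ t, ∑ p ∈ t.erase x,
        ∫ y in dualEdge t x p, F y ∂(Measure.hausdorffMeasure 1) := by
  set E : Finset Plane → Set Plane := fun t => ⋃ p ∈ t.erase x, dualEdge t x p
  have hsub : (⋃ t ∈ T.filter (x ∈ ·), E t) ⊆ frontier (controlVolume T x) := by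
    simp only [Set.iUnion_subset_iff, Finset.mem_filter, Finset.mem_erase, E]
    rintro t ⟨ht, hxt⟩ p ⟨hpx, hp⟩ y hy
    exact (hT.isOuterUnitNormal_of_mem_dualEdge ht hxt hp hpx.symm hy).mem_frontier
  have hdiff : frontier (controlVolume T x) \ (⋃ t ∈ T.filter (x ∈ ·), E t) ⊆
      ((T.biUnion fun t => insert (t.centroid ℝ id) (t.image (midpoint ℝ x)) : Finset Plane) :
        Set Plane) := by
    rintro y ⟨hy, hyn⟩
    obtain ⟨t, ht, hxt, p, hp, hpx, h⟩ := hT.mem_frontier_controlVolume hΩ hx hy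
    simp only [Finset.coe_biUnion, Set.mem_iUnion, Finset.mem_coe]
    refine ⟨t, ht, ?_⟩
    rcases h with h | rfl | rfl
    · exfalso
      apply hyn
      simp only [Set.mem_iUnion, E, Finset.mem_filter, Finset.mem_erase]
      exact ⟨t, ⟨ht, hxt⟩, p, ⟨hpx, hp⟩, h⟩
    · exact Finset.mem_insert_of_mem (Finset.mem_image_of_mem _ hp)
    · exact Finset.mem_insert_self _ _
  have := Measure.nullSingletonClass_hausdorff Plane (d := 1) one_pos
  have hae : frontier (controlVolume T x) =ᵐ[Measure.hausdorffMeasure 1]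
      (⋃ t ∈ T.filter (x ∈ ·), E t : Set Plane) := by
    refine (ae_le_set.2 ?_).antisymm hsub.eventuallyLE
    exact measure_mono_null hdiff ((Finset.finite_toSet _).measure_zero _)
  have hinner : ∀ t ∈ T, x ∈ t → IntegrableOn F (E t) (Measure.hausdorffMeasure 1) ∧
      ∫ y in E t, F y ∂(Measure.hausdorffMeasure 1) = ∑ p ∈ t.erase x,
        ∫ y in dualEdge t x p, F y ∂(Measure.hausdorffMeasure 1) := by
    intro t ht hxt
    refine ⟨(integrableOn_finset_iUnion).2 (hF t ht hxt), ?_⟩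
    refine integral_biUnion_finset _ (fun p _ => measurableSet_dualEdge t x p) ?_ (hF t ht hxt)
    intro p hp q hq hpq
    simp only [Finset.coe_erase, Set.mem_sdiff, Finset.mem_coe, Set.mem_singleton_iff] at hp hq
    refine Set.disjoint_left.2 fun y hy hy' => ?_
    -- On one edge the coordinate at q is strictly below that at x, on the other they are equal.
    have h1 := hy.2.2 q hq.1 hq.2 hpq.symm
    exact h1.ne hy'.2.1.symm
  rw [setIntegral_congr_set hae, integral_biUnion_finset]
  · refine Finset.sum_congr rfl fun t ht => ?_
    rw [Finset.mem_filter] at ht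
    exact (hinner t ht.1 ht.2).2
  · exact fun t _ => Finset.measurableSet_biUnion _ fun p _ => measurableSet_dualEdge t x p
  · intro s hs t ht hst
    simp only [Finset.coe_filter, Set.mem_ofPred_eq] at hs ht
    refine Set.disjoint_left.2 fun y hy hy' => hst ?_
    simp only [E, Set.mem_iUnion] at hy hy'
    obtain ⟨p, -, hp⟩ := hy
    obtain ⟨q, -, hq⟩ := hy'
    exact hT.eq_of_mem_interior hs.1 ht.1 (interior_subset hp.1) hq.1
  · intro t ht
    rw [Finset.mem_filter] at ht
    exact (hinner t ht.1 ht.2).1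

/-- The interiors are disjoint, and what they miss lies in the boundaries of convex sets, which are
null. -/
lemma IsTriangulation.setIntegral_eq_sum (hT : IsTriangulation Ω T)
    (hsub : ∀ t ∈ T, interior (tri t) ⊆ Ω) {F : Plane → ℝ}
    (hF : ∀ t ∈ T, IntegrableOn F (interior (tri t))) :
    ∫ y in Ω, F y = ∑ t ∈ T, ∫ y in interior (tri t), F y := by
  have hae : Ω =ᵐ[volume] (⋃ t ∈ T, interior (tri t) : Set Plane) := by
    refine (ae_le_set.2 ?_).antisymm (Set.iUnion₂_subset hsub).eventuallyLE
    have hd : Ω \ (⋃ t ∈ T, interior (tri t)) ⊆ ⋃ t ∈ T, frontier (tri t) := by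
      rintro y ⟨hy, hyn⟩
      have := subset_closure hy
      rw [← hT.cover] at this
      simp only [Set.mem_iUnion, exists_prop] at this hyn ⊢
      obtain ⟨t, ht, hyt⟩ := this
      exact ⟨t, ht, subset_closure hyt, fun h => hyn ⟨t, ht, h⟩⟩
    refine measure_mono_null hd ((measure_biUnion_null_iff T.countable_toSet).2 fun t _ => ?_)
    exact (convex_convexHull ℝ (t : Set Plane)).addHaar_frontier volume
  rw [setIntegral_congr_set hae]
  refine integral_biUnion_finset _ (fun t _ => isOpen_interior.measurableSet) ?_ hF
  intro s hs t ht hst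
  exact Set.disjoint_left.2 fun y hy hy' =>
    hst (hT.eq_of_mem_interior hs ht (interior_subset hy) hy')

end Decomposition

/-! ### Comparison of the two forms on one triangle -/

section LocalEstimate

variable {t : Finset Plane} {A : Plane → Matrix (Fin 2) (Fin 2) ℝ} {x p : Plane} {L : ℝ}

/-- The unit normal to the dual edge between `x` and `p`, pointing away from `x`. -/
def edgeNormal (t : Finset Plane) (x p : Plane) : Plane :=
  ‖affGrad (bary t p - bary t x)‖⁻¹ • affGrad (bary t p - bary t x)

lemma edgeNormal_comm (t : Finset Plane) (x p : Plane) :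
    edgeNormal t p x = -edgeNormal t x p := by
  rw [edgeNormal, edgeNormal, affGrad_sub, affGrad_sub, norm_sub_rev, ← smul_neg, neg_sub]

lemma norm_edgeNormal_le (t : Finset Plane) (x p : Plane) : ‖edgeNormal t x p‖ ≤ 1 := by
  rw [edgeNormal, norm_smul, norm_inv, norm_norm]
  exact inv_mul_le_one

/-- The flux of `A V` through the dual edge between `x` and `p`, in the direction away from `x`. -/
def edgeFlux (A : Plane → Matrix (Fin 2) (Fin 2) ℝ) (t : Finset Plane) (V x p : Plane) : ℝ :=
  ∫ y in dualEdge t x p, inner ℝ (act (A y) V) (edgeNormal t x p) ∂(Measure.hausdorffMeasure 1)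

/-- The two cells share the edge with opposite normals. This conservation property turns vertex
values of the test function into differences. -/
lemma edgeFlux_comm (A : Plane → Matrix (Fin 2) (Fin 2) ℝ) (t : Finset Plane) (V x p : Plane) :
    edgeFlux A t V p x = -edgeFlux A t V x p := by
  rw [edgeFlux, edgeFlux, dualEdge_comm, edgeNormal_comm]
  simp only [inner_neg_right]
  rw [integral_neg]

lemma isBounded_tri (t : Finset Plane) : Bornology.IsBounded (tri t) :=
  (t.finite_toSet.isCompact_convexHull ℝ).isBounded

lemma norm_sub_le_diam_tri {y z : Plane} (hy : y ∈ tri t) (hz : z ∈ tri t) :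
    ‖y - z‖ ≤ Metric.diam (tri t) := by
  rw [← dist_eq_norm]; exact Metric.dist_le_diam_of_mem (isBounded_tri t) hy hz

namespace IsTriangle

lemma hausdorffMeasure_dualEdge_ne_top (ht : IsTriangle t) (hx : x ∈ t) (hp : p ∈ t)
    (hxp : x ≠ p) : Measure.hausdorffMeasure 1 (dualEdge t x p) ≠ ⊤ := by
  rw [ht.hausdorffMeasure_dualEdge hx hp hxp]; exact ENNReal.ofReal_ne_top

lemma hausdorffMeasure_real_dualEdge (ht : IsTriangle t) (hx : x ∈ t) (hp : p ∈ t)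
    (hxp : x ≠ p) : (Measure.hausdorffMeasure 1).real (dualEdge t x p) =
      ‖t.centroid ℝ id - midpoint ℝ x p‖ := by
  rw [Measure.real, ht.hausdorffMeasure_dualEdge hx hp hxp,
    ENNReal.toReal_ofReal (norm_nonneg _)]

variable (ht : IsTriangle t) (hA : ContinuousOn A (interior (tri t)))
  (hL : ∀ y ∈ interior (tri t), ∀ i j, |A y i j - A (t.centroid ℝ id) i j| ≤ L)
include ht hA hL

/-- For the frozen coefficient the edge length cancels the normalization of the normal. The
remainder is the oscillation of A times the edge length, which is at most the diameter. -/
lemma abs_edgeFlux_sub_le (hL0 : 0 ≤ L) (hx : x ∈ t) (hp : p ∈ t) (hxp : x ≠ p) (V : Plane) :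
    |edgeFlux A t V x p - volume.real (interior (tri t)) / 3 *
      inner ℝ (act (A (t.centroid ℝ id)) V) (affGrad (bary t p) - affGrad (bary t x))| ≤
      4 * L * ‖V‖ * Metric.diam (tri t) := by
  have h := abs_setIntegral_inner_act_sub_le hA hL (fun y hy => hy.1)
    (measurableSet_dualEdge t x p) (ht.hausdorffMeasure_dualEdge_ne_top hx hp hxp) V
    (edgeNormal t x p)
  rw [ht.hausdorffMeasure_real_dualEdge hx hp hxp] at h
  have hlen := ht.norm_centroid_sub_midpoint hx hp hxp
  have e : ‖t.centroid ℝ id - midpoint ℝ x p‖ *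
      inner ℝ (act (A (t.centroid ℝ id)) V) (edgeNormal t x p) =
      volume.real (interior (tri t)) / 3 *
        inner ℝ (act (A (t.centroid ℝ id)) V) (affGrad (bary t p) - affGrad (bary t x)) := by
    rw [hlen, edgeNormal, inner_smul_right, affGrad_sub]
    by_cases h0 : ‖affGrad (bary t p) - affGrad (bary t x)‖ = 0
    · rw [norm_eq_zero.1 h0]; simp
    · field_simp
  rw [e] at h
  refine h.trans ?_
  have h1 := norm_sub_le_diam_tri (interior_subset ht.centroid_mem_interior)
    (midpoint_mem_tri hx hp)
  have h2 := norm_edgeNormal_le t x p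
  rw [← mul_assoc]
  refine mul_le_mul ?_ h1 (norm_nonneg _) (by positivity)
  exact mul_le_of_le_one_right (by positivity) h2

open Classical in
/-- The local comparison of the finite volume form and the Galerkin form. -/
lemma abs_sum_edgeFlux_add_integral_le (hL0 : 0 ≤ L)
    (hsymm : ∀ y ∈ interior (tri t), (A y).IsSymm) {κ : ℝ}
    (hκ : Metric.diam (tri t) ^ 2 ≤ κ ^ 2 * volume.real (interior (tri t)))
    (V : Plane) (ℓ : Plane →ᵃ[ℝ] ℝ) :
    |-∑ x ∈ t, ℓ x * ∑ p ∈ t.erase x, edgeFlux A t V x p -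
      ∫ y in interior (tri t), inner ℝ V (act (A y) (affGrad ℓ))| ≤
      (12 * κ ^ 2 + 4) * L * (‖V‖ * ‖affGrad ℓ‖) * volume.real (interior (tri t)) := by
  set c := t.centroid ℝ id
  set τ := volume.real (interior (tri t))
  set d := Metric.diam (tri t)
  set W := affGrad ℓ with hW
  have hd : 0 ≤ d := Metric.diam_nonneg
  have hvol : |(∫ y in interior (tri t), inner ℝ V (act (A y) W)) - τ * inner ℝ (act (A c) V) W| ≤
      4 * L * (‖V‖ * ‖W‖) * τ := by
    have : ∫ y in interior (tri t), inner ℝ V (act (A y) W) =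
        ∫ y in interior (tri t), inner ℝ (act (A y) V) W :=
      setIntegral_congr_fun isOpen_interior.measurableSet fun y hy =>
        inner_act_comm (hsymm y hy) V W
    rw [this]
    exact abs_setIntegral_inner_act_sub_le hA hL subset_rfl isOpen_interior.measurableSet
      ((isBounded_tri t).subset interior_subset).measure_lt_top.ne V W
  obtain ⟨x, p, q, hxp, hxq, hpq, htt⟩ := Finset.card_eq_three.1 ht.card_eq
  have hx : x ∈ t := by simp [htt]
  have hp : p ∈ t := by simp [htt]
  have hq : q ∈ t := by simp [htt]
  set Q := act (A c) V
  set err : Plane → Plane → ℝ := fun a b =>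
    edgeFlux A t V a b - τ / 3 * inner ℝ Q (affGrad (bary t b) - affGrad (bary t a)) with herr
  have hedge : ∀ a ∈ t, ∀ b ∈ t, a ≠ b → |(ℓ a - ℓ b) * err a b| ≤
      4 * κ ^ 2 * L * (‖V‖ * ‖W‖) * τ := by
    intro a ha b hb hab
    have h1 : |ℓ a - ℓ b| ≤ ‖W‖ * d := (abs_affine_sub_le ℓ b a).trans
      (mul_le_mul_of_nonneg_left (norm_sub_le_diam_tri (subset_tri t ha) (subset_tri t hb))
        (norm_nonneg _))
    have h2 := ht.abs_edgeFlux_sub_le hA hL hL0 ha hb hab V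
    rw [abs_mul]
    calc |ℓ a - ℓ b| * |err a b| ≤ (‖W‖ * d) * (4 * L * ‖V‖ * d) :=
          mul_le_mul h1 h2 (abs_nonneg _) (by positivity)
      _ = 4 * L * (‖V‖ * ‖W‖) * d ^ 2 := by ring
      _ ≤ 4 * L * (‖V‖ * ‖W‖) * (κ ^ 2 * τ) := by gcongr
      _ = _ := by ring
  have e1 : t.erase x = {p, q} := by
    ext z; simp only [htt, Finset.mem_erase, Finset.mem_insert, Finset.mem_singleton]
    grind
  have e2 : t.erase p = {x, q} := by
    ext z; simp only [htt, Finset.mem_erase, Finset.mem_insert, Finset.mem_singleton]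
    grind
  have e3 : t.erase q = {x, p} := by
    ext z; simp only [htt, Finset.mem_erase, Finset.mem_insert, Finset.mem_singleton]
    grind
  have hsum := ht.sum_affGrad_bary
  have hWs := ht.affGrad_eq_sum ℓ
  rw [sum_triple _ hxp hxq.symm hpq.symm htt] at hsum hWs
  have hsum' : inner ℝ Q (affGrad (bary t x)) + inner ℝ Q (affGrad (bary t p)) +
      inner ℝ Q (affGrad (bary t q)) = 0 := by
    rw [← inner_add_right, ← inner_add_right, hsum, inner_zero_right]
  have hWi : inner ℝ Q W = ℓ x * inner ℝ Q (affGrad (bary t x)) +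
      ℓ p * inner ℝ Q (affGrad (bary t p)) + ℓ q * inner ℝ Q (affGrad (bary t q)) := by
    rw [hW, hWs, inner_add_right, inner_add_right, inner_smul_right, inner_smul_right,
      inner_smul_right]
  -- Each edge occurs twice with opposite signs. The frozen parts add up to τ⟨Q, W⟩ because the
  -- gradients of the coordinates sum to zero, leaving only the errors.
  have hmain : -∑ x ∈ t, ℓ x * ∑ p ∈ t.erase x, edgeFlux A t V x p - τ * inner ℝ Q W =
      -((ℓ x - ℓ p) * err x p) - (ℓ x - ℓ q) * err x q - (ℓ p - ℓ q) * err p q := by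
    rw [sum_triple _ hxp hxq.symm hpq.symm htt, e1, e2, e3, Finset.sum_pair hpq,
      Finset.sum_pair hxq, Finset.sum_pair hxp, edgeFlux_comm A t V x p, edgeFlux_comm A t V x q,
      edgeFlux_comm A t V p q, hWi]
    simp only [herr, inner_sub_right]
    linear_combination (-(τ / 3) * (ℓ x + ℓ p + ℓ q)) * hsum'
  have b1 := abs_le.1 (hedge x hx p hp hxp)
  have b2 := abs_le.1 (hedge x hx q hq hxq)
  have b3 := abs_le.1 (hedge p hp q hq hpq)
  have b4 := abs_le.1 hvol
  rw [abs_le]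
  -- Three edge errors with factor 4κ² each, and one area error with factor 4.
  have hexp : (12 * κ ^ 2 + 4) * L * (‖V‖ * ‖W‖) * τ =
    3 * (4 * κ ^ 2 * L * (‖V‖ * ‖W‖) * τ) + 4 * L * (‖V‖ * ‖W‖) * τ := by ring
  rw [hexp]
  constructor <;> linarith [b1.1, b1.2, b2.1, b2.2, b3.1, b3.2, b4.1, b4.2]

end IsTriangle

end LocalEstimate

/-! ### Summation over the triangulation -/

section GlobalEstimate

variable {Ω : Set Plane} {T : Finset (Finset Plane)} {t : Finset Plane} {m : ℕ}
  {D : Fin m → Set Plane} {A : Plane → Matrix (Fin 2) (Fin 2) ℝ} {C κ : ℝ} {u v : Plane → ℝ}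

lemma diam_tri_le_meshSize (ht : t ∈ T) : Metric.diam (tri t) ≤ meshSize T := by
  have h := Finset.le_sup (f := fun t => Real.toNNReal (Metric.diam (tri t))) ht
  rw [meshSize]
  calc Metric.diam (tri t) = (Real.toNNReal (Metric.diam (tri t)) : ℝ) :=
        (Real.coe_toNNReal _ Metric.diam_nonneg).symm
    _ ≤ _ := by exact_mod_cast h

lemma volume_real_tri (t : Finset Plane) :
    volume.real (interior (tri t)) = volume.real (tri t) :=
  measureReal_congr
    (interior_ae_eq_of_null_frontier ((convex_convexHull ℝ (t : Set Plane)).addHaar_frontier _))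

/-- Compare with the area of the inscribed disc, using only π ≥ 1. -/
lemma IsShapeRegular.diam_sq_le (h : IsShapeRegular κ T) (hκ : 0 < κ) (ht : t ∈ T) :
    Metric.diam (tri t) ^ 2 ≤ κ ^ 2 * volume.real (interior (tri t)) := by
  obtain ⟨z, hz⟩ := h t ht
  have hd : 0 ≤ Metric.diam (tri t) / κ := div_nonneg Metric.diam_nonneg hκ.le
  have hle := measureReal_mono (μ := volume) hz (isBounded_tri t).measure_lt_top.ne
  rw [← volume_real_tri, Measure.real, EuclideanSpace.volume_closedBall_fin_two,
    ENNReal.toReal_mul, ENNReal.toReal_pow, ENNReal.toReal_ofReal hd,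
    ENNReal.toReal_ofReal Real.pi_pos.le] at hle
  have h1 : (Metric.diam (tri t) / κ) ^ 2 ≤ volume.real (interior (tri t)) := by
    nlinarith [sq_nonneg (Metric.diam (tri t) / κ), Real.pi_gt_three]
  rw [div_pow, div_le_iff₀ (by positivity)] at h1
  linarith

/-- The interior is convex, so the segment to the centroid stays in a single subdomain and crosses
no interface. -/
lemma IsCoefficient.abs_sub_centroid_le (hA : IsCoefficient D A C) (hC : 0 ≤ C)
    (hD : ∀ j, IsOpen (D j)) (ht : IsTriangle t) {j : Fin m} (hj : interior (tri t) ⊆ D j) :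
    ∀ y ∈ interior (tri t), ∀ p q, |A y p q - A (t.centroid ℝ id) p q| ≤
      2 * C * Metric.diam (tri t) := by
  intro y hy p q
  have hseg : segment ℝ (t.centroid ℝ id) y ⊆ D j :=
    ((convex_convexHull ℝ (t : Set Plane)).interior.segment_subset ht.centroid_mem_interior
      hy).trans hj
  refine ((hA.norm_le j p q).abs_sub_le_of_segment_subset (hD j)
    ((continuous_apply_apply p q).comp_continuousOn (hA.continuousOn j)) hC hseg).trans ?_
  exact mul_le_mul_of_nonneg_left (norm_sub_le_diam_tri (interior_subset hy)
    (interior_subset ht.centroid_mem_interior)) (by positivity)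

lemma MemVh.eq_zero_of_notMem (hT : IsTriangulation Ω T) (hΩ : IsOpen Ω) (hv : MemVh Ω T v)
    (ht : t ∈ T) {x : Plane} (hx : x ∈ t) (hxΩ : x ∉ Ω) : v x = 0 := by
  refine hv.boundary x ?_
  rw [hΩ.frontier_eq, ← hT.cover]
  exact ⟨Set.mem_biUnion ht (subset_tri t hx), hxΩ⟩

open Classical in
/-- The finite volume form written as a sum of edge fluxes over all triangles. -/
lemma ah_eq_sum_edgeFlux (hT : IsTriangulation Ω T) (hΩ : IsOpen Ω)
    {ℓu ℓv : Finset Plane → Plane →ᵃ[ℝ] ℝ} (hu : ∀ t ∈ T, Set.EqOn u (ℓu t) (tri t))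
    (hv : ∀ t ∈ T, Set.EqOn v (ℓv t) (tri t)) (hvV : MemVh Ω T v)
    (hint : ∀ t ∈ T, ∀ x ∈ t, ∀ p ∈ t, x ≠ p → ∀ V W : Plane,
      IntegrableOn (fun y => inner ℝ (act (A y) V) W) (dualEdge t x p)
        (Measure.hausdorffMeasure 1)) :
    ah Ω T A u v =
      ∑ t ∈ T, -∑ x ∈ t, ℓv t x * ∑ p ∈ t.erase x, edgeFlux A t (affGrad (ℓu t)) x p := by
  have hcongr : ∀ x ∈ Ω, ∀ t ∈ T, x ∈ t → ∀ p ∈ t.erase x, Set.EqOn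
      (fun y => inner ℝ (act (A y) (gradient u y)) (outerUnitNormal (controlVolume T x) y))
      (fun y => inner ℝ (act (A y) (affGrad (ℓu t))) (edgeNormal t x p)) (dualEdge t x p) := by
    intro x _ t ht hxt p hp y hy
    rw [Finset.mem_erase] at hp
    simp only
    rw [gradient_eq_affGrad (hu t ht) hy.1, (hT.isOuterUnitNormal_of_mem_dualEdge ht hxt hp.2
      hp.1.symm hy).outerUnitNormal_eq, edgeNormal]
  have hflux : ∀ x ∈ innerVertices Ω T, IhStar Ω T v x * boundaryFlux A u (controlVolume T x) =
      ∑ t ∈ T with x ∈ t, ℓv t x * ∑ p ∈ t.erase x, edgeFlux A t (affGrad (ℓu t)) x p := by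
    intro x hx
    have hxΩ := (mem_innerVertices.1 hx).2
    rw [hT.IhStar_eq v hx, boundaryFlux, hT.setIntegral_frontier_controlVolume hΩ hxΩ,
      Finset.mul_sum]
    · refine Finset.sum_congr rfl fun t ht => ?_
      rw [Finset.mem_filter] at ht
      rw [hv t ht.1 (subset_tri t ht.2)]
      congr 1
      refine Finset.sum_congr (by congr) fun p hp => ?_
      exact setIntegral_congr_fun (measurableSet_dualEdge t x p)
        (hcongr x hxΩ t ht.1 ht.2 p (by simpa using hp))
    · intro t ht hxt p hp
      have hp' := Finset.mem_erase.1 hp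
      exact (hint t ht x hxt p hp'.2 hp'.1.symm _ _).congr_fun
        (hcongr x hxΩ t ht hxt p (by simpa using hp)).symm (measurableSet_dualEdge t x p)
  rw [ah, aFV, Finset.sum_congr rfl hflux, Finset.sum_neg_distrib]
  congr 1
  simp only [Finset.sum_filter]
  rw [Finset.sum_comm]
  refine Finset.sum_congr rfl fun t ht => ?_
  rw [← Finset.sum_filter]
  -- Adding the vertices on the boundary of Ω changes nothing, since v vanishes there.
  refine Finset.sum_subset_zero_on_sdiff ?_ ?_ fun _ _ => rfl
  · intro x hx; exact (Finset.mem_filter.1 hx).2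
  · intro x hx
    rw [Finset.mem_sdiff, Finset.mem_filter, mem_innerVertices] at hx
    have hxΩ : x ∉ Ω := fun h => hx.2 ⟨⟨⟨t, ht, hx.1⟩, h⟩, hx.1⟩
    rw [← hv t ht (subset_tri t hx.1), hvV.eq_zero_of_notMem hT hΩ ht hx.1 hxΩ, zero_mul]

theorem abs_ah_sub_galerkin_le (hκ : 0 < κ) (hC : 0 < C) (hΩ : IsOpen Ω)
    (hD : IsPolygonalDecomposition Ω D) (hA : IsCoefficient D A C) (hT : IsTriangulation Ω T)
    (hreg : IsShapeRegular κ T) (hal : IsAligned D T) (huV : MemVh Ω T u) (hvV : MemVh Ω T v) :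
    |ah Ω T A u v - galerkin Ω A u v| ≤
      (12 * κ ^ 2 + 4) * (2 * C) * meshSize T * energyNorm Ω A u * energyNorm Ω A v := by
  choose j hj using hal
  choose! ℓu hu using huV.affine
  choose! ℓv hv using hvV.affine
  have hDo : ∀ j, IsOpen (D j) := fun j => (hD.polygonal j).isOpen
  have hcont : ∀ t ∈ T, ContinuousOn A (interior (tri t)) := fun t ht =>
    (hA.continuousOn (j t ht)).mono (hj t ht)
  have hL : ∀ t ∈ T, ∀ y ∈ interior (tri t), ∀ p q, |A y p q - A (t.centroid ℝ id) p q| ≤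
      2 * C * Metric.diam (tri t) := fun t ht =>
    hA.abs_sub_centroid_le hC.le hDo (hT.isTriangle ht) (hj t ht)
  have hsymm : ∀ t ∈ T, ∀ y ∈ interior (tri t), (A y).IsSymm := fun t ht y hy =>
    hA.symm (j t ht) y (hj t ht hy)
  have hfin : ∀ t : Finset Plane, volume (interior (tri t)) ≠ ⊤ := fun t =>
    ((isBounded_tri t).subset interior_subset).measure_lt_top.ne
  have hsub : ∀ t ∈ T, interior (tri t) ⊆ Ω := fun t ht => (hj t ht).trans (hD.subset _)
  have hvint : ∀ t ∈ T, ∀ V W : Plane,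
      IntegrableOn (fun y => inner ℝ V (act (A y) W)) (interior (tri t)) := by
    intro t ht V W
    have := integrableOn_inner_act (μ := volume) (hcont t ht) (hL t ht) subset_rfl
      isOpen_interior.measurableSet (hfin t) W V
    simpa only [real_inner_comm] using this
  have hgal : ∀ {f g : Plane → ℝ} {ℓf ℓg : Finset Plane → Plane →ᵃ[ℝ] ℝ},
      (∀ t ∈ T, Set.EqOn f (ℓf t) (tri t)) → (∀ t ∈ T, Set.EqOn g (ℓg t) (tri t)) →
      galerkin Ω A f g = ∑ t ∈ T, ∫ y in interior (tri t),
        inner ℝ (affGrad (ℓf t)) (act (A y) (affGrad (ℓg t))) := by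
    intro f g ℓf ℓg hf hg
    have hcongr : ∀ t ∈ T, Set.EqOn (fun y => inner ℝ (gradient f y) (act (A y) (gradient g y)))
        (fun y => inner ℝ (affGrad (ℓf t)) (act (A y) (affGrad (ℓg t)))) (interior (tri t)) := by
      intro t ht y hy
      simp only
      rw [gradient_eq_affGrad (hf t ht) hy, gradient_eq_affGrad (hg t ht) hy]
    rw [galerkin, hT.setIntegral_eq_sum hsub]
    · exact Finset.sum_congr rfl fun t ht =>
        setIntegral_congr_fun isOpen_interior.measurableSet (hcongr t ht)
    · exact fun t ht => (hvint t ht _ _).congr_fun (hcongr t ht).symm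
        isOpen_interior.measurableSet
  -- Ellipticity with constant 1 bounds the L² norm of the gradient by the energy norm.
  have henergy : ∀ {f : Plane → ℝ} {ℓf : Finset Plane → Plane →ᵃ[ℝ] ℝ},
      (∀ t ∈ T, Set.EqOn f (ℓf t) (tri t)) →
      √(∑ t ∈ T, (‖affGrad (ℓf t)‖ * √(volume.real (interior (tri t)))) ^ 2) ≤
        energyNorm Ω A f := by
    intro f ℓf hf
    rw [energyNorm, hgal hf hf]
    refine Real.sqrt_le_sqrt (Finset.sum_le_sum fun t ht => ?_)
    rw [mul_pow, Real.sq_sqrt measureReal_nonneg]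
    have hc : ∫ _ in interior (tri t), ‖affGrad (ℓf t)‖ ^ 2 =
        ‖affGrad (ℓf t)‖ ^ 2 * volume.real (interior (tri t)) := by
      rw [setIntegral_const, smul_eq_mul, mul_comm]
    rw [← hc]
    exact setIntegral_mono_on (integrableOn_const (hfin t)) (hvint t ht _ _)
      isOpen_interior.measurableSet fun y hy => hA.elliptic (j t ht) y (hj t ht hy) _
  have hah := ah_eq_sum_edgeFlux (A := A) hT hΩ hu hv hvV
    (fun t ht x hx p hp hxp V W => integrableOn_inner_act (hcont t ht) (hL t ht)
      (fun y hy => hy.1) (measurableSet_dualEdge t x p)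
      ((hT.isTriangle ht).hausdorffMeasure_dualEdge_ne_top hx hp hxp) V W)
  rw [hah, hgal hu hv, ← Finset.sum_sub_distrib]
  have hmesh : 0 ≤ meshSize T := NNReal.coe_nonneg _
  set K : ℝ := (12 * κ ^ 2 + 4) * (2 * C) * meshSize T with hK
  have hK0 : 0 ≤ K := by positivity
  calc _ ≤ ∑ t ∈ T, K * ((‖affGrad (ℓu t)‖ * √(volume.real (interior (tri t)))) *
          (‖affGrad (ℓv t)‖ * √(volume.real (interior (tri t))))) := by
        refine (Finset.abs_sum_le_sum_abs _ _).trans (Finset.sum_le_sum fun t ht => ?_)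
        have hloc := (hT.isTriangle ht).abs_sum_edgeFlux_add_integral_le (hcont t ht) (hL t ht)
          (mul_nonneg (by positivity) Metric.diam_nonneg) (hsymm t ht)
          (hreg.diam_sq_le hκ ht) (affGrad (ℓu t)) (ℓv t)
        refine hloc.trans ?_
        have hsq := Real.mul_self_sqrt (measureReal_nonneg (μ := volume) (s := interior (tri t)))
        calc _ ≤ (12 * κ ^ 2 + 4) * (2 * C * meshSize T) *
              (‖affGrad (ℓu t)‖ * ‖affGrad (ℓv t)‖) * volume.real (interior (tri t)) := by
              gcongr
              exact diam_tri_le_meshSize ht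
          _ = K * ((‖affGrad (ℓu t)‖ * √(volume.real (interior (tri t)))) *
              (‖affGrad (ℓv t)‖ * √(volume.real (interior (tri t))))) := by
              rw [hK]; linear_combination
                -((12 * κ ^ 2 + 4) * (2 * C * meshSize T) *
                  (‖affGrad (ℓu t)‖ * ‖affGrad (ℓv t)‖)) * hsq
    _ ≤ K * (√(∑ t ∈ T, (‖affGrad (ℓu t)‖ * √(volume.real (interior (tri t)))) ^ 2) *
          √(∑ t ∈ T, (‖affGrad (ℓv t)‖ * √(volume.real (interior (tri t)))) ^ 2)) := by
        rw [← Finset.mul_sum]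
        exact mul_le_mul_of_nonneg_left (Real.sum_mul_le_sqrt_mul_sqrt _ _ _) hK0
    _ ≤ K * (energyNorm Ω A u * energyNorm Ω A v) := by
        refine mul_le_mul_of_nonneg_left ?_ hK0
        exact mul_le_mul (henergy hu) (henergy hv) (Real.sqrt_nonneg _) (Real.sqrt_nonneg _)
    _ = _ := by ring

end GlobalEstimate

end FVE

end

theorem proposition6p1 (κ C_Ω : ℝ) (hκ : 0 < κ) (hC : 0 < C_Ω) :
    ∃ C_E : ℝ, 0 < C_E ∧
      ∀ (Ω : Set FVE.Plane) (m : ℕ) (D : Fin m → Set FVE.Plane)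
        (A : FVE.Plane → Matrix (Fin 2) (Fin 2) ℝ) (T : Finset (Finset FVE.Plane)),
        FVE.IsPolygonalDomain Ω →
        FVE.IsPolygonalDecomposition Ω D →
        FVE.IsCoefficient D A C_Ω →
        FVE.IsTriangulation Ω T →
        FVE.IsShapeRegular κ T →
        FVE.IsAligned D T →
        ∀ u v : FVE.Plane → ℝ, FVE.MemVh Ω T u → FVE.MemVh Ω T v →
          |FVE.ah Ω T A u v - FVE.galerkin Ω A u v| ≤
            C_E * FVE.meshSize T * FVE.energyNorm Ω A u * FVE.energyNorm Ω A v :=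
  ⟨(12 * κ ^ 2 + 4) * (2 * C_Ω), by positivity,
    fun _ _ _ _ _ hΩ hD hA hT hreg hal _ _ hu hv =>
      FVE.abs_ah_sub_galerkin_le hκ hC hΩ.isOpen hD hA hT hreg hal hu hv⟩
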